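/- Let $p$ be an odd prime, $K=\mathbb{Q}(\zeta)$ with $\zeta$ a primitive $p$-th root of unity, $\mathbb{Z}[\zeta]$ its ring of integers, and $\pi=(\zeta-1)$ its prime ideal above $p$. Let $v$ be a primitive root modulo $p$, let $\sigma$ be the automorphism of $K$ with $\sigma(\zeta)=\zeta^{v}$, and for $n\in\mathbb{Z}$ let $v_n\in\{1,\dots,p-1\}$ be the residue of $v^n$ modulo $p$. Put $P(\sigma)=\sum_{i=0}^{p-2}v_{-i}\,\sigma^i\in\mathbb{Z}[\mathrm{Gal}(K/\mathbb{Q})]$, so that $A^{P(\sigma)}=\prod_{i=0}^{p-2}\sigma^i(A)^{v_{-i}}$. Let $\mathbf{q}$ be a prime ideal of $\mathbb{Z}[\zeta]$ lying over a rational prime $q\ne p$. Let $A\in\mathbb{Z}[\zeta]$ be singular ($A$ is not a $p$-th power in $K$, and $A\,\mathbb{Z}[\zeta]$ is the $p$-th power of an ideal) and semi-primary ($A\equiv a \bmod \pi^2$ for some natural number $a$ coprime to $p$), with $A\,\mathbb{Z}[\zeta]=\mathbf{q}^{p}$ or $A\,\mathbb{Z}[\zeta]=\mathbf{q}^{2p}$.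 Then there is a sign $\delta\in\{1,-1\}$ such that: 1. if $q\equiv 1 \bmod p$, then $A^{P(\sigma)}\equiv\delta \bmod \pi^{2p-1}$; 2. if $q\not\equiv 1 \bmod p$, then $A^{P(\sigma)}\equiv\delta \bmod \pi^{2p}$; 3. $\pi^{2p-1}$ exactly divides $A^{P(\sigma)}-\delta$ (that is, $\pi^{2p-1}$ divides it and $\pi^{2p}$ does not) if and only if $q\equiv 1\bmod p$ and $p^{(q-1)/p}\not\equiv 1 \bmod q$. -/

import Mathlib

open scoped NumberField

/-- A singular integer of a number field `K` (relative to the prime `p`): an algebraic integer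
that is not a `p`-th power in `K` and that generates the `p`-th power of an ideal. -/
def IsSingularInt (p : ℕ) {K : Type*} [Field K] (A : 𝓞 K) : Prop :=
  (¬ ∃ x : K, x ^ p = (A : K)) ∧ ∃ 𝔞 : Ideal (𝓞 K), Ideal.span {A} = 𝔞 ^ p

/-- The ideal `π = (ζ - 1)`. It is the prime above `p` when `ζ` is a primitive `p`-th root of
unity in the `p`-th cyclotomic field. -/
def primeAbove {K : Type*} [Field K] (ζ : 𝓞 K) : Ideal (𝓞 K) :=
  Ideal.span {ζ - 1}

/-- Semi-primary: congruent modulo `π ^ 2` to a natural number coprime to `p`. -/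
def IsSemiPrimary (p : ℕ) {K : Type*} [Field K] (ζ A : 𝓞 K) : Prop :=
  ∃ a : ℕ, a.Coprime p ∧ A - (a : 𝓞 K) ∈ primeAbove ζ ^ 2

/-- `v_n`, the residue of `v ^ n` modulo `p`, for `n ∈ ℤ` (it lies between `1` and `p - 1` for
prime `p`). -/
def residuePow {p : ℕ} (v : (ZMod p)ˣ) (n : ℤ) : ℕ :=
  ((v ^ n : (ZMod p)ˣ) : ZMod p).val

/-- `A ^ P(σ)` for `P(σ) = ∑_{i=0}^{p-2} v_{-i} σ ^ i` in the group ring `ℤ[Gal(K/ℚ)]`,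
that is `∏_{i=0}^{p-2} (σ ^ i A) ^ v_{-i}`. -/
noncomputable def stickelbergerPow {p : ℕ} {K : Type*} [Field K] [NumberField K]
    (v : (ZMod p)ˣ) (σ : Gal(K/ℚ)) (A : 𝓞 K) : 𝓞 K :=
  ∏ i ∈ Finset.range (p - 1), ((σ ^ i) • A) ^ residuePow v (-(i : ℤ))

/-!
The number `A ^ P(σ)` is compared with a power of a Gauss sum.

Let `𝔽` be the residue field of `𝔮`, with `q ^ f` elements, `χ` the multiplicative character of
order `p` of `𝔽` attached to `𝔮`, `ψ` the additive character `x ↦ η ^ Tr x` with `η` a primitive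
`q`-th root of unity, and `g` the Gauss sum of `χ` and `ψ`. Then `G = (-g) ^ p` lies in `ℤ[ζ]`, and
by Stickelberger's theorem it generates `𝔮 ^ P(σ)`. Hence if `A` generates `𝔮 ^ (e p)` with
`e ∈ {1, 2}`, the numbers `A ^ P(σ)` and `G ^ (p e)` generate the same ideal. They also have the
same absolute value at every complex embedding, so by Kronecker's theorem they differ by a root of
unity `± ζ ^ r`. As `A` is semi-primary, both are congruent to integers modulo `(ζ - 1) ^ 2`, which
forces `ζ ^ r = 1` (`exists_sign_mul_stickelbergerPow_eq`).

It remains to expand `G ^ (p e)` at `λ = ζ - 1`. Write `-g = 1 + λ b` and `χ(p) = ζ ^ i`. Modulo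
`λ`, the Frobenius map multiplies the argument of `ψ` by `p`, which gives `b ^ p ≡ b - i`. As
`p ≡ -λ ^ (p - 1) mod λ ^ p`, this yields `G ≡ 1 + λ ^ p (b ^ p - b) ≡ 1 - i λ ^ p mod λ ^ (p + 1)`,
and then `G ^ (p e) ≡ 1 + e i λ ^ (2 p - 1) mod λ ^ (2 p)` (`exists_neg_gaussSum_pow_eq`). So
`λ ^ (2 p)` divides the deviation from `±1` exactly when `χ(p) = 1`. This always holds when
`q ≢ 1 mod p`, because then `q - 1` divides `(q ^ f - 1) / p`; when `q ≡ 1 mod p` the residue field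
is `𝔽_q`, and the condition reads `p ^ ((q - 1) / p) ≡ 1 mod q`.

Of Stickelberger's theorem only the divisibility `𝔮 ^ P(σ) ∣ G` is needed, since the absolute values
take care of the rest. For it, one passes to a field `L` that contains the roots of unity of order
`q` and `q ^ f - 1`. There the Teichmüller character `ω` exists, `χ` is a power of `ω⁻¹`, and the
Gauss sum of `ω⁻¹` is `η - 1` times a local unit (`exists_gaussSum_inv_eq_mul_sub_one`). The
factorization of Jacobi sums bounds the valuation of every other Gauss sum from above by the sum of
the base `q` digits of the exponent (`exists_gaussSum_pow_mul_eq`), and `|g|² = q ^ f` turns the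
upper bound for the inverse character into the lower bound that is wanted
(`exists_gaussSum_pow_mul_unit_eq`).
-/

/-! ### Divisibility between Gauss sums over a finite field -/

section GaussSumDvd

variable {F R : Type*} [Field F] [Fintype F] [CommRing R] [IsDomain R]

/-- The quotient is a Jacobi sum, or a sign when `a + b = 0`. -/
theorem gaussSum_pow_add_dvd {χ : MulChar F R} {ψ : AddChar F R} (hψ : ψ ≠ 1) {a b : ℕ}
    (hab : a + b < orderOf χ) :
    gaussSum (χ ^ (a + b)) ψ ∣ gaussSum (χ ^ a) ψ * gaussSum (χ ^ b) ψ := by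
  rcases Nat.eq_zero_or_pos (a + b) with h0 | h0
  · rw [h0, pow_zero, gaussSum_one_left hψ]
    exact (isUnit_one.neg).dvd
  · have h : χ ^ a * χ ^ b ≠ 1 := by
      rw [← pow_add]
      exact pow_ne_one_of_lt_orderOf h0.ne' hab
    rw [pow_add, ← jacobiSum_mul_nontrivial h]
    exact dvd_mul_right _ _

theorem gaussSum_pow_mul_dvd {χ : MulChar F R} {ψ : AddChar F R} (hψ : ψ ≠ 1) (e d : ℕ)
    (hde : d * e < orderOf χ) :
    gaussSum (χ ^ (d * e)) ψ ∣ gaussSum (χ ^ e) ψ ^ d := by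
  induction d with
  | zero =>
    rw [zero_mul, pow_zero, gaussSum_one_left hψ]
    exact (isUnit_one.neg).dvd
  | succ d ih =>
    rw [Nat.succ_mul] at hde ⊢
    exact (gaussSum_pow_add_dvd hψ hde).trans
      (by rw [pow_succ]; exact mul_dvd_mul_right (ih (by omega)) _)

/-- Gauss sums are submultiplicative along an expansion `∑ dᵢ eᵢ` of the exponent that stays
below the order of the character. -/
theorem gaussSum_pow_sum_dvd {χ : MulChar F R} {ψ : AddChar F R} (hψ : ψ ≠ 1) (d e : ℕ → ℕ)
    (n : ℕ) (hn : ∑ i ∈ Finset.range n, d i * e i < orderOf χ) :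
    gaussSum (χ ^ ∑ i ∈ Finset.range n, d i * e i) ψ ∣
      ∏ i ∈ Finset.range n, gaussSum (χ ^ e i) ψ ^ d i := by
  induction n with
  | zero =>
    rw [Finset.range_zero, Finset.sum_empty, pow_zero, gaussSum_one_left hψ]
    exact (isUnit_one.neg).dvd
  | succ n ih =>
    rw [Finset.sum_range_succ] at hn ⊢
    rw [Finset.prod_range_succ]
    exact (gaussSum_pow_add_dvd hψ hn).trans
      (mul_dvd_mul (ih (by omega)) (gaussSum_pow_mul_dvd hψ _ _ (by omega)))

end GaussSumDvd

/-! ### The additive character given by the trace to the prime field -/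

section TraceChar

variable {F R : Type*} [Field F] [Fintype F] [CommRing R]
variable (q : ℕ) [Fact q.Prime] [Algebra (ZMod q) F]

/-- The additive character `x ↦ η ^ Tr x` of a finite field of characteristic `q`, where `η` is a
`q`-th root of unity. -/
noncomputable def traceAddChar (F : Type*) [Field F] [Fintype F] [Algebra (ZMod q) F] {η : R}
    (hη : η ^ q = 1) : AddChar F R :=
  (AddChar.zmodChar q hη).compAddMonoidHom (Algebra.trace (ZMod q) F).toAddMonoidHom

variable {q}

theorem traceAddChar_apply {η : R} (hη : η ^ q = 1) (x : F) :
    traceAddChar q F hη x = η ^ (Algebra.trace (ZMod q) F x).val := by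
  simp [traceAddChar, AddChar.zmodChar_apply]

theorem traceAddChar_ne_one {η : R} (hη : IsPrimitiveRoot η q) :
    traceAddChar q F hη.pow_eq_one ≠ 1 := by
  obtain ⟨x, hx⟩ := Algebra.trace_surjective (ZMod q) F 1
  intro h
  have hq : 1 < q := (Fact.out : q.Prime).one_lt
  have : Fact (1 < q) := ⟨hq⟩
  have hx1 := congrArg (fun φ : AddChar F R => φ x) h
  simp only [traceAddChar_apply, AddChar.one_apply, hx] at hx1
  rw [ZMod.val_one, pow_one] at hx1
  exact hη.ne_one hq hx1

theorem traceAddChar_isPrimitive {η : R} (hη : IsPrimitiveRoot η q) :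
    (traceAddChar q F hη.pow_eq_one).IsPrimitive :=
  AddChar.IsPrimitive.of_ne_one (traceAddChar_ne_one hη)

theorem traceAddChar_pow {η : R} (hη : η ^ q = 1) (n : ℕ) (x : F) :
    traceAddChar q F hη x ^ n = traceAddChar q F hη (n * x) := by
  rw [← nsmul_eq_mul, AddChar.map_nsmul_eq_pow]

theorem traceAddChar_frobenius {η : R} (hη : η ^ q = 1) (x : F) :
    traceAddChar q F hη (x ^ q) = traceAddChar q F hη x := by
  have : CharP F q := charP_of_injective_algebraMap (algebraMap (ZMod q) F).injective q
  rw [traceAddChar_apply, traceAddChar_apply]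
  have h := Algebra.trace_eq_of_algEquiv
    (FiniteField.frobeniusAlgEquivOfAlgebraic (ZMod q) F) x
  rw [FiniteField.coe_frobeniusAlgEquivOfAlgebraic] at h
  simp only [ZMod.card] at h
  rw [h]

/-- Gauss sums are invariant under the Frobenius map of the source field. -/
theorem gaussSum_pow_char {η : R} (hη : η ^ q = 1) (χ : MulChar F R) (j : ℕ) :
    gaussSum (χ ^ q ^ j) (traceAddChar q F hη) = gaussSum χ (traceAddChar q F hη) := by
  have : CharP F q := charP_of_injective_algebraMap (algebraMap (ZMod q) F).injective q
  have hq0 : q ≠ 0 := (Fact.out : q.Prime).ne_zero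
  induction j with
  | zero => simp
  | succ j ih =>
    rw [← ih, pow_succ, pow_mul]
    refine Fintype.sum_bijective (frobeniusEquiv F q) (frobeniusEquiv F q).bijective _ _ ?_
    intro x
    simp only [frobeniusEquiv_def]
    rw [traceAddChar_frobenius, MulChar.pow_apply' _ hq0, map_pow]

end TraceChar

/-! ### The Gauss sum of the inverse Teichmüller character -/

section LeadingTerm

variable {F R k : Type*} [Field F] [Fintype F] [CommRing R] [Field k]
variable {q : ℕ} [Fact q.Prime] [Algebra (ZMod q) F]

/-- By `Tr x = ∑ x ^ (q ^ j)`, this is a sum of power sums over `F`, of which only the one of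
exponent `0` survives. -/
theorem sum_inv_mul_trace :
    ∑ x : F, x⁻¹ * algebraMap (ZMod q) F (Algebra.trace (ZMod q) F x) = -1 := by
  classical
  have hq : 1 < q := (Fact.out : q.Prime).one_lt
  have hcard : Fintype.card F = q ^ Module.finrank (ZMod q) F := by
    rw [Module.card_eq_pow_finrank (K := ZMod q), ZMod.card]
  have hf : 0 < Module.finrank (ZMod q) F := Module.finrank_pos
  obtain ⟨f, hf'⟩ := Nat.exists_eq_succ_of_ne_zero hf.ne'
  simp only [FiniteField.algebraMap_trace_eq_sum_pow, Finset.mul_sum, Nat.card_zmod]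
  rw [Finset.sum_comm, hf', Finset.sum_range_succ']
  have h1 : ∑ x : F, x⁻¹ * x ^ q ^ 0 = -1 := by
    have : ∀ x : F, x⁻¹ * x ^ q ^ 0 = 1 - if x = 0 then 1 else 0 := by
      intro x
      split_ifs with h
      · simp [h]
      · simp [h]
    rw [Finset.sum_congr rfl fun x _ => this x]
    simp
  rw [h1, Finset.sum_eq_zero, zero_add]
  intro j hj
  have hj' := Finset.mem_range.1 hj
  have hlt : 1 < q ^ (j + 1) := Nat.one_lt_pow (by omega) hq
  rw [← FiniteField.sum_pow_lt_card_sub_one F (q ^ (j + 1) - 1)]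
  · refine Finset.sum_congr rfl fun x _ => ?_
    rcases eq_or_ne x 0 with rfl | hx
    · rw [zero_pow (by omega), zero_pow (by omega), mul_zero]
    · rw [pow_sub₀ x hx (by omega), pow_one, mul_comm]
  · have : q ^ (j + 1) < q ^ (f + 1) := Nat.pow_lt_pow_right hq (by omega)
    rw [hcard, hf']
    simp only [Nat.succ_eq_add_one]
    omega

/-- The Gauss sum of the inverse of a character `ω` lifting the identity of `F` (a Teichmüller
character) equals `η - 1` times an element that is a unit at the residue map `red`: expanding
`η ^ Tr x = 1 + (η - 1) (Tr x + ⋯)`, the coefficient of `η - 1` reduces to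
`∑ x⁻¹ Tr x = -1`. -/
theorem exists_gaussSum_inv_eq_mul_sub_one [IsDomain R] (hF : 2 < Fintype.card F)
    (red : R →+* k) (ι : F →+* k) (ω : MulChar F R) (hω : ∀ x, red (ω x) = ι x)
    {η : R} (hη : η ^ q = 1) :
    ∃ u : R, red u ≠ 0 ∧ gaussSum ω⁻¹ (traceAddChar q F hη) = u * (η - 1) := by
  have hCF : CharP F q := charP_of_injective_algebraMap (algebraMap (ZMod q) F).injective q
  have hCk : CharP k q := charP_of_injective_ringHom ι.injective q
  have hω1 : ω ≠ 1 := by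
    classical
    obtain ⟨x, hx⟩ := Finset.exists_mem_notMem_of_card_lt_card
      (s := {0, 1}) (t := (Finset.univ : Finset F))
      (lt_of_le_of_lt (Finset.card_le_two) (by simpa using hF))
    simp only [Finset.mem_univ, Finset.mem_insert, Finset.mem_singleton, not_or, true_and] at hx
    intro h
    have := hω x
    rw [h, MulChar.one_apply (isUnit_iff_ne_zero.2 hx.1), map_one] at this
    exact hx.2 (ι.injective (by rw [← this, map_one]))
  have hredη : red η = 1 := by
    have : frobenius k q (red η) = frobenius k q 1 := by
      rw [frobenius_def, frobenius_def, ← map_pow, hη, map_one, one_pow]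
    exact frobenius_inj k q this
  have hredinv : ∀ x, red (ω⁻¹ x) = ι x⁻¹ := by
    intro x
    rw [MulChar.inv_apply', hω]
  refine ⟨∑ x : F, ω⁻¹ x *
    ∑ i ∈ Finset.range (Algebra.trace (ZMod q) F x).val, η ^ i, ?_, ?_⟩
  · have : red (∑ x : F, ω⁻¹ x *
        ∑ i ∈ Finset.range (Algebra.trace (ZMod q) F x).val, η ^ i) = ι (-1) := by
      rw [← sum_inv_mul_trace (q := q), map_sum, map_sum]
      refine Finset.sum_congr rfl fun x _ => ?_
      rw [map_mul, map_mul, hredinv, map_sum]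
      congr 1
      simp only [map_pow, hredη, one_pow, Finset.sum_const, Finset.card_range, nsmul_eq_mul,
        mul_one]
      conv_rhs => rw [← ZMod.natCast_zmod_val (Algebra.trace (ZMod q) F x), map_natCast,
        map_natCast]
    rw [this]
    simp
  · rw [Finset.sum_mul, gaussSum]
    have h0 : ∑ x : F, ω⁻¹ x = 0 := MulChar.sum_eq_zero_of_ne_one (inv_ne_one.2 hω1)
    rw [← sub_zero (∑ x : F, ω⁻¹ x * traceAddChar q F hη x), ← h0, ← Finset.sum_sub_distrib]
    refine Finset.sum_congr rfl fun x _ => ?_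
    rw [mul_assoc, geom_sum_mul, traceAddChar_apply, mul_sub, mul_one]

end LeadingTerm

/-! ### Base `q` digits of multiples of `(q ^ f - 1) / p` -/

section Digits

variable {p q f M : ℕ} [Fact p.Prime]

/-- Division of `q y` by `p` with remainder, for residues `y` modulo `p`. -/
theorem mul_val_eq_mul_div_add_val (q : ℕ) (y : ZMod p) :
    p * (q * y.val / p) + (q * y : ZMod p).val = q * y.val := by
  have : (q * y : ZMod p).val = q * y.val % p := by
    rw [← ZMod.val_natCast]
    simp
  rw [this, Nat.div_add_mod]

/-- The floors `⌊q rⱼ / p⌋`, where `rⱼ` is the residue of `q ^ j x` modulo `p`, are the base `q`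
digits of `⌊q ^ n r₀ / p⌋`, with leading digit first. -/
theorem mul_sum_digits_add_val (x : ZMod p) (n : ℕ) :
    p * ∑ j ∈ Finset.range n, (q * (q ^ j * x : ZMod p).val / p) * q ^ (n - 1 - j) +
      (q ^ n * x : ZMod p).val = q ^ n * x.val := by
  induction n with
  | zero => simp
  | succ n ih =>
    rw [Finset.sum_range_succ]
    have h1 : ∑ j ∈ Finset.range n, (q * (q ^ j * x : ZMod p).val / p) * q ^ (n + 1 - 1 - j) =
        q * ∑ j ∈ Finset.range n, (q * (q ^ j * x : ZMod p).val / p) * q ^ (n - 1 - j) := by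
      rw [Finset.mul_sum]
      refine Finset.sum_congr rfl fun j hj => ?_
      have := Finset.mem_range.1 hj
      rw [show n + 1 - 1 - j = (n - 1 - j) + 1 by omega, pow_succ]
      ring
    have h2 := mul_val_eq_mul_div_add_val q (q ^ n * x : ZMod p)
    rw [← mul_assoc, ← pow_succ'] at h2
    rw [h1, pow_succ' q n, mul_assoc q (q ^ n) x.val, ← ih]
    simp only [add_tsub_cancel_right, tsub_self, pow_zero, mul_one]
    linarith

/-- The base `q` expansion of `M x`, where `M = (q ^ f - 1) / p`. -/
theorem sum_digits_eq (hq : (q ^ f : ZMod p) = 1) (hM : p * M = q ^ f - 1) (hq0 : 0 < q)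
    (x : ZMod p) :
    ∑ j ∈ Finset.range f, (q * (q ^ j * x : ZMod p).val / p) * q ^ (f - 1 - j) = M * x.val := by
  have h := mul_sum_digits_add_val (q := q) x f
  rw [hq, one_mul] at h
  have hp : 0 < p := (Fact.out : p.Prime).pos
  have h1 : 1 ≤ q ^ f := Nat.one_le_pow _ _ hq0
  have h2 : q ^ f = p * M + 1 := by omega
  rw [h2, add_mul, one_mul, mul_assoc] at h
  exact Nat.eq_of_mul_eq_mul_left hp (by omega)

/-- The digit sum of `M x`, where `M = (q ^ f - 1) / p`, is `(q - 1) / p` times the sum of the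
residues of `q ^ j x` modulo `p`. -/
theorem mul_digit_sum_eq (hq : (q ^ f : ZMod p) = 1) (x : ZMod p) :
    p * ∑ j ∈ Finset.range f, (q * (q ^ j * x : ZMod p).val / p) =
      (q - 1) * ∑ j ∈ Finset.range f, (q ^ j * x : ZMod p).val := by
  have h : p * ∑ j ∈ Finset.range f, (q * (q ^ j * x : ZMod p).val / p) +
      ∑ j ∈ Finset.range f, (q ^ (j + 1) * x : ZMod p).val =
      q * ∑ j ∈ Finset.range f, (q ^ j * x : ZMod p).val := by
    rw [Finset.mul_sum, Finset.mul_sum, ← Finset.sum_add_distrib]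
    refine Finset.sum_congr rfl fun j _ => ?_
    rw [pow_succ', mul_assoc]
    exact mul_val_eq_mul_div_add_val q (q ^ j * x : ZMod p)
  have h2 : ∑ j ∈ Finset.range f, (q ^ (j + 1) * x : ZMod p).val =
      ∑ j ∈ Finset.range f, (q ^ j * x : ZMod p).val := by
    have h3 := Finset.sum_range_succ (fun j => (q ^ j * x : ZMod p).val) f
    rw [Finset.sum_range_succ'] at h3
    simp only [hq, pow_zero] at h3
    exact Nat.add_right_cancel h3
  rw [h2] at h
  rw [Nat.sub_mul, one_mul]
  omega

theorem sum_val_add_sum_val_neg (hq : (q : ZMod p) ≠ 0) {x : ZMod p} (hx : x ≠ 0) (f : ℕ) :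
    ∑ j ∈ Finset.range f, (q ^ j * x : ZMod p).val +
      ∑ j ∈ Finset.range f, (q ^ j * -x : ZMod p).val = p * f := by
  rw [← Finset.sum_add_distrib, Finset.sum_congr rfl (g := fun _ => p)]
  · simp [mul_comm]
  · intro j _
    have : NeZero (q ^ j * x : ZMod p) := ⟨mul_ne_zero (pow_ne_zero _ hq) hx⟩
    rw [mul_neg, ZMod.val_neg_of_ne_zero]
    have := (ZMod.val_lt (q ^ j * x : ZMod p)).le
    omega

end Digits

/-! ### The divisibility form of Stickelberger's theorem for Gauss sums -/

section Stickelberger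

variable {F R k : Type*} [Field F] [Fintype F] [CommRing R] [Field k]
variable {p q f M : ℕ} [Fact p.Prime]

theorem card_sub_one_le_orderOf {red : R →+* k} {ι : F →+* k}
    {ω : MulChar F R} (hω : ∀ x, red (ω x) = ι x) :
    Fintype.card F - 1 ≤ orderOf ω := by
  refine Nat.le_of_dvd ω.orderOf_pos ?_
  rw [← FiniteField.forall_pow_eq_one_iff]
  intro x
  have h1 : red ((ω ^ orderOf ω) x) = 1 := by
    rw [pow_orderOf_eq_one, MulChar.one_apply_coe, map_one]
  rw [MulChar.pow_apply_coe, map_pow, hω, ← map_pow, ← map_one ι] at h1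
  exact Units.ext (by simpa using ι.injective h1)

theorem mul_val_lt_orderOf_inv (hF : Fintype.card F = q ^ f) (hF2 : 2 < Fintype.card F)
    {red : R →+* k} {ι : F →+* k} {ω : MulChar F R} (hω : ∀ x, red (ω x) = ι x)
    (hM : p * M = q ^ f - 1) (x : ZMod p) : M * x.val < orderOf ω⁻¹ := by
  rw [orderOf_inv]
  refine lt_of_lt_of_le ?_ (card_sub_one_le_orderOf hω)
  rw [hF, ← hM, mul_comm p]
  refine Nat.mul_lt_mul_of_pos_left (ZMod.val_lt x) ?_
  rcases Nat.eq_zero_or_pos M with h | h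
  · rw [h] at hM
    omega
  · exact h

omit [Fact p.Prime] in
theorem mulChar_pow_pow_eq_one (hF : Fintype.card F = q ^ f) (hM : p * M = q ^ f - 1)
    (χ : MulChar F R) : (χ ^ M) ^ p = 1 := by
  classical
  have h1 : χ ^ Fintype.card Fˣ = 1 := MulChar.pow_card_eq_one _
  rwa [Fintype.card_units, hF, ← hM, mul_comm, pow_mul] at h1

variable [IsDomain R] [Fact q.Prime] [Algebra (ZMod q) F]

/-- Upper bound for the order of vanishing of the Gauss sum of `ω ^ (-M x)` at the residue map
`red`: writing `M x` in base `q`, this Gauss sum divides a power of the Gauss sum of `ω⁻¹`. -/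
theorem exists_gaussSum_pow_mul_eq (hF : Fintype.card F = q ^ f) (hF2 : 2 < Fintype.card F)
    (red : R →+* k) (ι : F →+* k) (ω : MulChar F R) (hω : ∀ x, red (ω x) = ι x)
    {η : R} (hη : IsPrimitiveRoot η q) (hqf : (q ^ f : ZMod p) = 1) (hM : p * M = q ^ f - 1)
    (x : ZMod p) :
    ∃ u y : R, red u ≠ 0 ∧
      gaussSum ((ω⁻¹ ^ M) ^ x.val) (traceAddChar q F hη.pow_eq_one) ^ p * y =
        u * q ^ ∑ j ∈ Finset.range f, (q ^ j * x : ZMod p).val := by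
  obtain ⟨u, hu, hg⟩ := exists_gaussSum_inv_eq_mul_sub_one hF2 red ι ω hω hη.pow_eq_one
  have hqp : q.Prime := Fact.out
  set ψ := traceAddChar q F hη.pow_eq_one
  have hlt := mul_val_lt_orderOf_inv hF hF2 hω hM x
  have hsum := sum_digits_eq hqf hM hqp.pos x
  have hdvd := gaussSum_pow_sum_dvd (χ := ω⁻¹) (ψ := ψ) (traceAddChar_ne_one hη)
    (fun j => q * (q ^ j * x : ZMod p).val / p) (fun j => q ^ (f - 1 - j)) f (by rwa [hsum])
  simp only [hsum, ψ, gaussSum_pow_char, Finset.prod_pow_eq_pow_sum] at hdvd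
  obtain ⟨z, -, hz⟩ := hη.self_sub_one_pow_dvd_order (Nat.sub_lt hqp.pos one_pos)
  obtain ⟨w, hw⟩ := pow_dvd_pow_of_dvd hdvd p
  rw [← pow_mul, mul_comm _ p, mul_digit_sum_eq hqf, hg, mul_pow,
    pow_mul (η - 1), mul_comm _ (w : R)] at hw
  refine ⟨u ^ ((q - 1) * ∑ j ∈ Finset.range f, (q ^ j * x : ZMod p).val),
    w * z ^ ∑ j ∈ Finset.range f, (q ^ j * x : ZMod p).val, ?_, ?_⟩
  · rw [map_pow]
    exact pow_ne_zero _ hu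
  · rw [hz, mul_pow, ← pow_mul ω⁻¹, ← mul_assoc, mul_comm _ w, ← hw]
    ring

/-- Lower bound for the order of vanishing of Gauss sums, obtained from the upper bound for the
complementary character and from `g(χ) g(χ⁻¹) = χ(-1) q ^ f`. -/
theorem exists_gaussSum_pow_mul_unit_eq (hF : Fintype.card F = q ^ f) (hF2 : 2 < Fintype.card F)
    (red : R →+* k) (ι : F →+* k) (ω : MulChar F R) (hω : ∀ x, red (ω x) = ι x)
    {η : R} (hη : IsPrimitiveRoot η q) (hqf : (q ^ f : ZMod p) = 1) (hM : p * M = q ^ f - 1)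
    (hp2 : p ≠ 2) (hq0 : (q : R) ≠ 0) {x : ZMod p} (hx : x ≠ 0) :
    ∃ u y : R, red u ≠ 0 ∧
      gaussSum ((ω⁻¹ ^ M) ^ x.val) (traceAddChar q F hη.pow_eq_one) ^ p * u =
        y * q ^ ∑ j ∈ Finset.range f, (q ^ j * x : ZMod p).val := by
  obtain ⟨u, y, hu, h⟩ := exists_gaussSum_pow_mul_eq hF hF2 red ι ω hω hη hqf hM (-x)
  have hp : p.Prime := Fact.out
  have hodd : Odd p := hp.odd_of_ne_two hp2
  set ψ := traceAddChar q F hη.pow_eq_one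
  set χ := ω⁻¹ ^ M
  have hf0 : f ≠ 0 := by
    rintro rfl
    rw [pow_zero] at hF
    omega
  have hqp : (q : ZMod p) ≠ 0 := by
    intro h0
    rw [h0, zero_pow hf0] at hqf
    exact zero_ne_one hqf
  have hχp : χ ^ p = 1 := mulChar_pow_pow_eq_one hF hM _
  have hneZ : NeZero x := ⟨hx⟩
  have hval : (-x).val = p - x.val := ZMod.val_neg_of_ne_zero x
  have hinv : χ ^ (-x).val = (χ ^ x.val)⁻¹ := by
    refine eq_inv_of_mul_eq_one_left ?_
    rw [hval, ← pow_add, Nat.sub_add_cancel (ZMod.val_lt x).le, hχp]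
  have hlt := mul_val_lt_orderOf_inv hF hF2 hω hM x
  have hχ1 : χ ^ x.val ≠ 1 := by
    rw [← pow_mul]
    refine pow_ne_one_of_lt_orderOf (mul_ne_zero ?_ ?_) hlt
    · rintro rfl
      omega
    · rwa [Ne, ZMod.val_eq_zero]
  have hsign : (χ ^ x.val) (-1) = 1 := by
    refine MulChar.val_neg_one_eq_one_of_odd_order hodd ?_
    rw [← pow_mul, mul_comm, pow_mul, hχp, one_pow]
  have hprod : gaussSum (χ ^ x.val) ψ * gaussSum (χ ^ (-x).val) ψ = q ^ f := by
    rw [hinv, ← mul_gaussSum_inv_eq_gaussSum (χ ^ x.val)⁻¹ ψ, mul_left_comm,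
      gaussSum_mul_gaussSum_eq_card hχ1 (traceAddChar_isPrimitive hη), MulChar.inv_apply',
      inv_neg_one, hsign, one_mul, hF, Nat.cast_pow]
  refine ⟨u, y, hu, ?_⟩
  have hadd := sum_val_add_sum_val_neg hqp hx f
  refine mul_right_cancel₀
    (pow_ne_zero (∑ j ∈ Finset.range f, (q ^ j * -x : ZMod p).val) hq0) ?_
  rw [mul_assoc, ← h, mul_assoc y, ← pow_add, hadd, mul_comm p f, pow_mul, ← hprod]
  ring

end Stickelberger

/-! ### Expansion of Gauss sums at `ζ - 1` -/

section LocalExpansion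

variable {R : Type*} [CommRing R] {p : ℕ} [Fact p.Prime]

theorem exists_one_add_pow_prime_eq (x : R) :
    ∃ r : R, (1 + x) ^ p = 1 + p * x + x ^ p + p * x ^ 2 * r := by
  have hp : p.Prime := Fact.out
  have h2 := hp.two_le
  have hIoo : Finset.Ioo 0 p = insert 1 (Finset.Ioo 1 p) := by
    ext k
    simp only [Finset.mem_Ioo, Finset.mem_insert]
    omega
  refine ⟨∑ k ∈ Finset.Ioo 1 p, x ^ (k - 2) * ((p.choose k / p : ℕ) : R), ?_⟩
  rw [add_comm 1 x, add_pow_prime_eq hp, hIoo, Finset.sum_insert (by simp)]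
  have : ∑ k ∈ Finset.Ioo 1 p, x ^ (k - 1) * 1 ^ (p - k - 1) * ((p.choose k / p : ℕ) : R) =
      x * ∑ k ∈ Finset.Ioo 1 p, x ^ (k - 2) * ((p.choose k / p : ℕ) : R) := by
    rw [Finset.mul_sum]
    refine Finset.sum_congr rfl fun k hk => ?_
    have := Finset.mem_Ioo.1 hk
    rw [show k - 1 = (k - 2) + 1 by omega, pow_succ, one_pow]
    ring
  rw [this, Nat.choose_one_right, Nat.div_self hp.pos]
  simp only [tsub_self, pow_zero, one_pow, Nat.cast_one]
  ring

theorem exists_one_add_pow_mul_pow_eq (l c : R) {m : ℕ} (hm : 0 < m) (e : ℕ) :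
    ∃ r : R, (1 + l ^ m * c) ^ e = 1 + l ^ m * (e * c + l * r) := by
  obtain ⟨m, rfl⟩ := Nat.exists_eq_succ_of_ne_zero hm.ne'
  induction e with
  | zero => exact ⟨0, by simp⟩
  | succ e ih =>
    obtain ⟨r, hr⟩ := ih
    refine ⟨r + l ^ m * c * (e * c + l * r), ?_⟩
    rw [pow_succ, hr]
    push_cast
    rw [Nat.succ_eq_add_one, pow_succ]
    ring

variable [IsDomain R] {ζ : R}

theorem natCast_eq_zero_mod_sub_one (hζ : IsPrimitiveRoot ζ p) :
    (p : R ⧸ Ideal.span {ζ - 1}) = 0 := by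
  obtain ⟨z, -, hz⟩ := hζ.self_sub_one_pow_dvd_order (Fact.out : p.Prime).one_lt
  rw [← map_natCast (Ideal.Quotient.mk (Ideal.span {ζ - 1})), Ideal.Quotient.eq_zero_iff_mem,
    Ideal.mem_span_singleton, hz, pow_one]
  exact dvd_mul_left _ _

omit [IsDomain R] in
theorem mk_eq_one (ζ : R) : Ideal.Quotient.mk (Ideal.span {ζ - 1}) ζ = 1 := by
  rw [← map_one (Ideal.Quotient.mk (Ideal.span {ζ - 1})), Ideal.Quotient.mk_eq_mk_iff_sub_mem]
  exact Ideal.mem_span_singleton_self _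

omit [IsDomain R] in
theorem mk_geom_sum (ζ : R) (n : ℕ) :
    Ideal.Quotient.mk (Ideal.span {ζ - 1}) (∑ i ∈ Finset.range n, ζ ^ i) = n := by
  simp [map_sum, map_pow, mk_eq_one]

omit [IsDomain R] in
theorem exists_eq_add_mul_of_mk_eq {a b l : R}
    (h : Ideal.Quotient.mk (Ideal.span {l}) a = Ideal.Quotient.mk (Ideal.span {l}) b) :
    ∃ r, a = b + l * r := by
  rw [Ideal.Quotient.mk_eq_mk_iff_sub_mem, Ideal.mem_span_singleton] at h
  obtain ⟨r, hr⟩ := h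
  exact ⟨r, by rw [← hr]; ring⟩

/-- In terms of the uniformizer `ζ - 1`, the prime `p` is `(ζ - 1) ^ (p - 1) (-1 + ⋯)`, by
Wilson's theorem. -/
theorem exists_natCast_eq_sub_one_pow_mul (hp2 : p ≠ 2) (hζ : IsPrimitiveRoot ζ p) :
    ∃ r : R, (p : R) = (ζ - 1) ^ (p - 1) * (-1 + (ζ - 1) * r) := by
  have hp : p.Prime := Fact.out
  have heven : Even (p - 1) := hp.even_sub_one hp2
  have hp1 : p - 1 + 1 = p := Nat.sub_add_cancel hp.one_le
  have hprod := IsPrimitiveRoot.prod_one_sub_pow_eq_order (n := p - 1) (by rwa [hp1])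
  have hcast : ((p - 1 : ℕ) : R) + 1 = p := by exact_mod_cast congrArg (Nat.cast (R := R)) hp1
  rw [hcast] at hprod
  have h1 : ∀ k ∈ Finset.range (p - 1), 1 - ζ ^ (k + 1) =
      (-(ζ - 1)) * ∑ i ∈ Finset.range (k + 1), ζ ^ i := by
    intro k _
    rw [neg_mul, mul_geom_sum]
    ring
  rw [Finset.prod_congr rfl h1, Finset.prod_mul_distrib, Finset.prod_const, Finset.card_range,
    heven.neg_pow] at hprod
  have h2 : Ideal.Quotient.mk (Ideal.span {ζ - 1})
      (∏ k ∈ Finset.range (p - 1), ∑ i ∈ Finset.range (k + 1), ζ ^ i) =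
      Ideal.Quotient.mk (Ideal.span {ζ - 1}) (-1) := by
    rw [map_prod, Finset.prod_congr rfl fun k _ => mk_geom_sum ζ (k + 1), ← Nat.cast_prod,
      Finset.prod_range_add_one_eq_factorial, map_neg, map_one, eq_neg_iff_add_eq_zero]
    have hdvd : p ∣ (p - 1).factorial + 1 := by
      rw [← ZMod.natCast_eq_zero_iff]
      push_cast
      rw [ZMod.wilsons_lemma]
      ring
    obtain ⟨m, hm⟩ := hdvd
    have hm' := congrArg (Nat.cast (R := R ⧸ Ideal.span {ζ - 1})) hm
    rwa [Nat.cast_mul, natCast_eq_zero_mod_sub_one hζ, zero_mul, Nat.cast_add, Nat.cast_one]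
      at hm'
  obtain ⟨r, hr⟩ := exists_eq_add_mul_of_mk_eq h2
  exact ⟨r, by rw [← hprod, hr]⟩

theorem exists_one_add_sub_one_mul_pow_eq (hp2 : p ≠ 2) (hζ : IsPrimitiveRoot ζ p) (b : R) :
    ∃ r : R, (1 + (ζ - 1) * b) ^ p = 1 + (ζ - 1) ^ p * (b ^ p - b + (ζ - 1) * r) := by
  obtain ⟨s, hs⟩ := exists_natCast_eq_sub_one_pow_mul hp2 hζ
  obtain ⟨t, ht⟩ := exists_one_add_pow_prime_eq (p := p) ((ζ - 1) * b)
  refine ⟨s * b + (-1 + (ζ - 1) * s) * b ^ 2 * t, ?_⟩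
  rw [ht]
  have hpow : (ζ - 1) ^ p = (ζ - 1) ^ (p - 1) * (ζ - 1) := by
    rw [← pow_succ, Nat.sub_add_cancel (Fact.out : p.Prime).one_le]
  rw [mul_pow, hpow, hs]
  ring

/-- Raising `1 + (ζ - 1) ^ p c` to the power `p` multiplies the deviation from `1` by `p`, which
shifts it by `p - 1` steps and changes the sign of its leading coefficient. -/
theorem exists_one_add_sub_one_pow_mul_pow_eq (hp2 : p ≠ 2) (hζ : IsPrimitiveRoot ζ p) (c : R) :
    ∃ r : R, (1 + (ζ - 1) ^ p * c) ^ p = 1 + (ζ - 1) ^ (2 * p - 1) * (-c + (ζ - 1) * r) := by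
  have hp : p.Prime := Fact.out
  have h3 : 3 ≤ p := by
    have := hp.two_le
    omega
  obtain ⟨s, hs⟩ := exists_natCast_eq_sub_one_pow_mul hp2 hζ
  obtain ⟨t, ht⟩ := exists_one_add_pow_prime_eq (p := p) ((ζ - 1) ^ p * c)
  refine ⟨s * c + (ζ - 1) ^ (p * p - 2 * p) * c ^ p +
    (-1 + (ζ - 1) * s) * (ζ - 1) ^ (p - 1) * c ^ 2 * t, ?_⟩
  rw [ht]
  have h1 : ((ζ - 1) ^ p) ^ p = (ζ - 1) ^ (2 * p - 1) * (ζ - 1) * (ζ - 1) ^ (p * p - 2 * p) := by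
    rw [← pow_succ, ← pow_add, ← pow_mul]
    congr 1
    have : 2 * p ≤ p * p := Nat.mul_le_mul_right _ hp.two_le
    omega
  have h2 : (ζ - 1) ^ (2 * p - 1) = (ζ - 1) ^ (p - 1) * (ζ - 1) ^ p := by
    rw [← pow_add]
    congr 1
    omega
  have h4 : (ζ - 1) ^ p = (ζ - 1) ^ (p - 1) * (ζ - 1) := by
    rw [← pow_succ, Nat.sub_add_cancel hp.one_le]
  rw [mul_pow, h1, h2, hs, mul_pow, h4]
  ring

variable {F : Type*} [Field F] [Fintype F] {q : ℕ} [Fact q.Prime] [Algebra (ZMod q) F]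

/-- The negative of the Gauss sum of a character `χ` of order `p` is `1 + (ζ - 1) b` with
`b = -∑ ind(x) η ^ Tr x` modulo `ζ - 1`, where `χ x = ζ ^ ind x`. Since `ind` is additive,
raising to the power `p` shows `b ^ p = b - ind p` modulo `ζ - 1`. -/
theorem exists_neg_gaussSum_eq_one_add (hζ : IsPrimitiveRoot ζ p)
    (hunit : ¬ IsUnit (ζ - 1)) {χ : MulChar F R} (hχ : χ ^ p = 1) {η : R}
    (hη : IsPrimitiveRoot η q) (hpF : (p : F) ≠ 0) {i : ℕ} (hi : χ p = ζ ^ i) (hp2 : p ≠ 2) :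
    ∃ b r : R, -gaussSum χ (traceAddChar q F hη.pow_eq_one) = 1 + (ζ - 1) * b ∧
      b ^ p = b - i + (ζ - 1) * r := by
  classical
  have hp : p.Prime := Fact.out
  have hodd : Odd p := hp.odd_of_ne_two hp2
  have : NeZero p := ⟨hp.ne_zero⟩
  set D := R ⧸ Ideal.span {ζ - 1} with hD
  set mk := Ideal.Quotient.mk (Ideal.span {ζ - 1}) with hmk
  have hnt : Nontrivial D := by
    rw [hD, Ideal.Quotient.nontrivial_iff, Ne, Ideal.span_singleton_eq_top]
    exact hunit
  have hchar : CharP D p :=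
    (CharP.charP_iff_prime_eq_zero hp).2 (natCast_eq_zero_mod_sub_one hζ)
  set ψ := traceAddChar q F hη.pow_eq_one with hψ
  have hind : ∀ x : F, ∃ k : ℕ, x ≠ 0 → χ x = ζ ^ k := by
    intro x
    by_cases hx : x = 0
    · exact ⟨0, fun h => absurd hx h⟩
    · obtain ⟨k, -, hk⟩ := MulChar.exists_apply_eq_pow hχ hζ hx
      exact ⟨k, fun _ => hk⟩
  choose ind hind using hind
  have hadd : ∀ x : F, x ≠ 0 → (ind x : D) = ind (p * x) - i := by
    intro x hx
    have h1 : ζ ^ (ind (p * x)) = ζ ^ (i + ind x) := by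
      rw [← hind _ (mul_ne_zero hpF hx), map_mul, hi, hind x hx, pow_add]
    rw [(hζ.isOfFinOrder hp.ne_zero).pow_inj_mod, ← hζ.eq_orderOf] at h1
    have h2 : ((ind (p * x) : ℕ) : D) = ((i + ind x : ℕ) : D) :=
      (CharP.natCast_eq_natCast D p).2 h1
    rw [h2]
    push_cast
    ring
  have hsum : ∑ x ∈ Finset.univ.erase (0 : F), ψ x = -1 := by
    rw [eq_neg_iff_add_eq_zero, ← AddChar.map_zero_eq_one ψ,
      Finset.sum_erase_add _ _ (Finset.mem_univ 0)]
    exact AddChar.sum_eq_zero_of_ne_one (traceAddChar_ne_one hη)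
  set b : R := -∑ x ∈ Finset.univ.erase (0 : F), (∑ j ∈ Finset.range (ind x), ζ ^ j) * ψ x
    with hb
  have hmkb : mk b = -∑ x ∈ Finset.univ.erase (0 : F), (ind x : D) * mk (ψ x) := by
    rw [hb, map_neg, map_sum]
    simp only [map_mul, hmk, mk_geom_sum]
  have hfrob : mk (b ^ p) = mk (b - i) := by
    rw [map_pow, hmkb, hodd.neg_pow, sum_pow_char]
    have h1 : ∀ x ∈ Finset.univ.erase (0 : F), ((ind x : D) * mk (ψ x)) ^ p =
        ((ind (p * x) : D) - i) * mk (ψ (p * x)) := by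
      intro x hx
      rw [mul_pow, ← map_pow, hψ, traceAddChar_pow, hadd x (Finset.ne_of_mem_erase hx),
        ← hadd x (Finset.ne_of_mem_erase hx), ← Nat.cast_pow]
      congr 1
      rw [Nat.cast_pow, ← frobenius_def, map_natCast]
    rw [Finset.sum_congr rfl h1]
    have h2 : ∑ x ∈ Finset.univ.erase (0 : F), ((ind (p * x) : D) - i) * mk (ψ (p * x)) =
        ∑ x ∈ Finset.univ.erase (0 : F), ((ind x : D) - i) * mk (ψ x) := by
      refine Finset.sum_nbij' (fun x => p * x) (fun x => (p : F)⁻¹ * x) ?_ ?_ ?_ ?_ ?_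
      · intro x hx
        simpa [hpF] using hx
      · intro x hx
        simpa [hpF] using hx
      · intro x _
        rw [inv_mul_cancel_left₀ hpF]
      · intro x _
        rw [mul_inv_cancel_left₀ hpF]
      · intro x _
        rfl
    have h3 : ∑ x ∈ Finset.univ.erase (0 : F), mk (ψ x) = -1 := by
      rw [← map_sum, hsum, map_neg, map_one]
    rw [h2, map_sub, hmkb, map_natCast]
    simp only [sub_mul, Finset.sum_sub_distrib]
    rw [← Finset.mul_sum, h3]
    ring
  obtain ⟨r, hr⟩ := exists_eq_add_mul_of_mk_eq hfrob
  refine ⟨b, r, ?_, hr⟩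
  rw [gaussSum, ← Finset.sum_erase_add _ _ (Finset.mem_univ (0 : F)), MulChar.map_zero, zero_mul,
    add_zero]
  have h4 : ∀ x ∈ Finset.univ.erase (0 : F), χ x * ψ x =
      ψ x + (ζ - 1) * ((∑ j ∈ Finset.range (ind x), ζ ^ j) * ψ x) := by
    intro x hx
    rw [hind x (Finset.ne_of_mem_erase hx), ← mul_assoc, mul_geom_sum]
    ring
  rw [Finset.sum_congr rfl h4, Finset.sum_add_distrib, hsum, ← Finset.mul_sum, hb]
  ring

/-- The expansion of `g(χ) ^ (p² e)` at `ζ - 1`: its leading coefficient records the value of `χ`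
at `p`. -/
theorem exists_neg_gaussSum_pow_eq (hζ : IsPrimitiveRoot ζ p)
    (hunit : ¬ IsUnit (ζ - 1)) {χ : MulChar F R} (hχ : χ ^ p = 1) {η : R}
    (hη : IsPrimitiveRoot η q) (hpF : (p : F) ≠ 0) {i : ℕ} (hi : χ p = ζ ^ i) (hp2 : p ≠ 2)
    (e : ℕ) :
    ∃ r : R, (((-gaussSum χ (traceAddChar q F hη.pow_eq_one)) ^ p) ^ p) ^ e =
      1 + (ζ - 1) ^ (2 * p - 1) * (e * i + (ζ - 1) * r) := by
  obtain ⟨b, r, hb, hbp⟩ := exists_neg_gaussSum_eq_one_add hζ hunit hχ hη hpF hi hp2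
  obtain ⟨s, hs⟩ := exists_one_add_sub_one_mul_pow_eq hp2 hζ b
  obtain ⟨t, ht⟩ := exists_one_add_sub_one_pow_mul_pow_eq hp2 hζ (b ^ p - b + (ζ - 1) * s)
  obtain ⟨w, hw⟩ := exists_one_add_pow_mul_pow_eq (ζ - 1)
    (-(b ^ p - b + (ζ - 1) * s) + (ζ - 1) * t) (m := 2 * p - 1)
    (by have := (Fact.out : p.Prime).two_le; omega) e
  rw [hb, hs, ht, hw, hbp]
  exact ⟨e * (-r - s + t) + w, by ring⟩

end LocalExpansion

/-! ### Galois action and absolute values of Gauss sums; the Teichmüller character -/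

section Functoriality

variable {F R k : Type*} [Field F] [Fintype F] [CommRing R] [IsDomain R] [Field k]

/-- Existence of the Teichmüller character: if `R` contains a primitive root of unity of order
`|F| - 1`, the embedding `ι` lifts along `red` to a multiplicative character. -/
theorem exists_mulChar_lift (red : R →+* k) (ι : F →+* k) {θ : R}
    (hθ : IsPrimitiveRoot θ (Fintype.card F - 1)) :
    ∃ ω : MulChar F R, ∀ x, red (ω x) = ι x := by
  classical
  have hn : 0 < Fintype.card F - 1 := Nat.sub_pos_of_lt Fintype.one_lt_card
  obtain ⟨g, hg⟩ := IsCyclic.exists_generator (α := Fˣ)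
  have hcard : Fintype.card Fˣ = Fintype.card F - 1 := Fintype.card_units F
  have hgpow : ι g ^ (Fintype.card F - 1) = 1 := by
    rw [← map_pow, ← Units.val_pow_eq_pow_val, ← hcard, pow_card_eq_one, Units.val_one, map_one]
  -- over `k`, the polynomial `X ^ n - 1` splits with roots the reductions of its roots in `R`
  have hprod := congrArg (fun P => Polynomial.eval₂ red (ι g) P)
    (Polynomial.X_pow_sub_one_eq_prod hn hθ)
  simp only [Polynomial.eval₂_sub, Polynomial.eval₂_pow, Polynomial.eval₂_X,
    Polynomial.eval₂_one, hgpow, sub_self, Polynomial.eval₂_finsetProd, Polynomial.eval₂_C]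
    at hprod
  obtain ⟨z, hz, hz0⟩ := Finset.prod_eq_zero_iff.1 hprod.symm
  have hzn : z ^ (Fintype.card F - 1) = 1 := (Polynomial.mem_nthRootsFinset hn _).1 hz
  set u : Rˣ := Units.ofPowEqOne z _ hzn hn.ne' with hu
  have hmem : u ∈ rootsOfUnity (Fintype.card Fˣ) R := by
    rw [mem_rootsOfUnity, hcard, hu]
    exact Units.pow_ofPowEqOne _ _
  refine ⟨MulChar.ofRootOfUnity hmem hg, fun x => ?_⟩
  rcases eq_or_ne x 0 with rfl | hx
  · rw [MulChar.map_zero, map_zero, map_zero]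
  · obtain ⟨m, hm⟩ := (Submonoid.mem_powers_iff _ _).1
      ((mem_powers_iff_mem_zpowers).2 (hg (Units.mk0 x hx)))
    have hx' : x = (g : F) ^ m := by
      rw [← Units.val_pow_eq_pow_val, hm, Units.val_mk0]
    rw [hx', map_pow, map_pow, map_pow, MulChar.ofRootOfUnity_spec, hu, Units.val_ofPowEqOne,
      sub_eq_zero.1 hz0]

variable {p q : ℕ} [Fact p.Prime] [Fact q.Prime] [Algebra (ZMod q) F]

/-- An automorphism raising `p`-th roots of unity to the power `a` maps `g(χ) ^ p` to
`g(χ ^ a) ^ p`, for any effect on the `q`-th roots of unity. -/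
theorem map_gaussSum_pow {χ : MulChar F R} (hχ : χ ^ p = 1) {ζ : R} (hζ : IsPrimitiveRoot ζ p)
    {η : R} (hη : IsPrimitiveRoot η q) (s : R →+* R) (hs : Function.Injective s) {a : ℕ}
    (ha : a ≠ 0) (hsζ : s ζ = ζ ^ a) :
    s (gaussSum χ (traceAddChar q F hη.pow_eq_one) ^ p) =
      gaussSum (χ ^ a) (traceAddChar q F hη.pow_eq_one) ^ p := by
  have hp : p.Prime := Fact.out
  have hq : q.Prime := Fact.out
  have : NeZero p := ⟨hp.ne_zero⟩
  have : NeZero q := ⟨hq.ne_zero⟩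
  have hCF : CharP F q := charP_of_injective_algebraMap (algebraMap (ZMod q) F).injective q
  obtain ⟨t, -, ht⟩ := hη.eq_pow_of_pow_eq_one (ξ := s η)
    (by rw [← map_pow, hη.pow_eq_one, map_one])
  have htF : (t : F) ≠ 0 := by
    rw [Ne, CharP.cast_eq_zero_iff F q]
    intro hdvd
    rw [← hη.pow_eq_one_iff_dvd] at hdvd
    rw [hdvd] at ht
    exact hη.ne_one hq.one_lt (hs (by rw [← ht, map_one]))
  set ψ := traceAddChar q F hη.pow_eq_one with hψ
  have h1 : s (gaussSum χ ψ) = gaussSum (χ ^ a) (ψ.mulShift (Units.mk0 (t : F) htF)) := by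
    rw [gaussSum, gaussSum, map_sum]
    refine Finset.sum_congr rfl fun x _ => ?_
    rw [map_mul, MulChar.pow_apply' _ ha]
    congr 1
    · rcases eq_or_ne x 0 with rfl | hx
      · rw [MulChar.map_zero, map_zero, zero_pow ha]
      · obtain ⟨k, -, hk⟩ := MulChar.exists_apply_eq_pow hχ hζ hx
        rw [hk, map_pow, hsζ, ← pow_mul, ← pow_mul, mul_comm]
    · rw [AddChar.mulShift_apply, Units.val_mk0, hψ, ← traceAddChar_pow, traceAddChar_apply,
        map_pow, ← ht, ← pow_mul, ← pow_mul, mul_comm]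
  rw [map_pow, h1, gaussSum_mulShift_eq, mul_pow, MulChar.inv_apply', ← Units.val_inv_eq_inv_val,
    ← MulChar.pow_apply_coe, ← pow_mul, mul_comm a p, pow_mul, hχ, one_pow, MulChar.one_apply_coe,
    one_mul]

omit [IsDomain R] in
/-- The classical `|g(χ)|² = |F|`, at any complex embedding of the coefficients. -/
theorem norm_gaussSum_sq (φ : R →+* ℂ) (hφ : Function.Injective φ) {χ : MulChar F R}
    (hχ : χ ≠ 1) {η : R} (hη : IsPrimitiveRoot η q) :
    ‖φ (gaussSum χ (traceAddChar q F hη.pow_eq_one))‖ ^ 2 = Fintype.card F := by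
  have hη' : IsPrimitiveRoot (φ η) q := hη.map_of_injective hφ
  have h1 : φ (gaussSum χ (traceAddChar q F hη.pow_eq_one)) =
      gaussSum (χ.ringHomComp φ) (traceAddChar q F hη'.pow_eq_one) := by
    simp [gaussSum, traceAddChar_apply]
  have hχ' : χ.ringHomComp φ ≠ 1 := (MulChar.ringHomComp_ne_one_iff hφ).2 hχ
  have h2 := gaussSum_mul_gaussSum_eq_card hχ' (traceAddChar_isPrimitive (F := F) hη')
  rw [← star_gaussSum_eq, ← starRingEnd_apply, Complex.mul_conj, ← h1,
    Complex.normSq_eq_norm_sq] at h2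
  exact_mod_cast h2

end Functoriality

/-! ### Descent to the ring of integers of the cyclotomic field -/

section Descent

variable {K L : Type*} [Field K] [NumberField K] [Field L] [NumberField L] [Algebra K L]

omit [NumberField K] [NumberField L] in
theorem NumberField.RingOfIntegers.dvd_of_algebraMap_dvd {a b : 𝓞 K}
    (h : algebraMap (𝓞 K) (𝓞 L) a ∣ algebraMap (𝓞 K) (𝓞 L) b) : a ∣ b := by
  rcases eq_or_ne a 0 with rfl | ha
  · rw [map_zero, zero_dvd_iff] at h
    rw [zero_dvd_iff]
    exact FaithfulSMul.algebraMap_injective (𝓞 K) (𝓞 L) (by rw [h, map_zero])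
  · obtain ⟨c, hc⟩ := h
    have haK : (a : K) ≠ 0 := by
      simpa using ha
    have hcL : algebraMap K L ((b : K) / a) = c := by
      have h1 := congrArg (algebraMap (𝓞 L) L) hc
      rw [map_mul, ← IsScalarTower.algebraMap_apply, ← IsScalarTower.algebraMap_apply,
        IsScalarTower.algebraMap_apply (𝓞 K) K L, IsScalarTower.algebraMap_apply (𝓞 K) K L] at h1
      rw [map_div₀, div_eq_iff ((map_ne_zero _).2 haK), mul_comm]
      exact h1
    have hint : IsIntegral ℤ ((b : K) / a) := by
      rw [← isIntegral_algebraMap_iff (algebraMap K L).injective, hcL]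
      exact c.isIntegral_coe
    obtain ⟨z, hz⟩ : ∃ z : 𝓞 K, (z : K) = (b : K) / a := ⟨⟨(b : K) / a, hint⟩, rfl⟩
    refine ⟨z, FaithfulSMul.algebraMap_injective (𝓞 K) K ?_⟩
    rw [map_mul]
    exact (by rw [hz, mul_div_cancel₀ (b : K) haK] : (b : K) = a * z)

/-- Membership in `𝔮 ^ c` can be tested in an extension, locally at one prime `𝔓` above `𝔮`. -/
theorem Ideal.mem_pow_of_algebraMap_mul_mem (𝔮 : Ideal (𝓞 K)) [𝔮.IsPrime] (h𝔮 : 𝔮 ≠ ⊥)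
    (𝔓 : Ideal (𝓞 L)) [𝔓.IsPrime] [𝔓.LiesOver 𝔮] {a : 𝓞 K} {u : 𝓞 L} (hu : u ∉ 𝔓) (c : ℕ)
    (h : algebraMap (𝓞 K) (𝓞 L) a * u ∈ (𝔮 ^ c).map (algebraMap (𝓞 K) (𝓞 L))) :
    a ∈ 𝔮 ^ c := by
  rcases eq_or_ne a 0 with rfl | ha
  · exact zero_mem _
  have h𝔓 : 𝔓 ≠ ⊥ := Ideal.ne_bot_of_liesOver_of_ne_bot h𝔮 𝔓
  have hq : Irreducible 𝔮 := (Ideal.prime_of_isPrime h𝔮 inferInstance).irreducible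
  have hP : Prime 𝔓 := Ideal.prime_of_isPrime h𝔓 inferInstance
  have he := Ideal.IsDedekindDomain.ramificationIdx'_ne_zero_of_liesOver 𝔓 h𝔮
  have h1 : emultiplicity 𝔓 ((𝔮 ^ c).map (algebraMap (𝓞 K) (𝓞 L))) ≤
      emultiplicity 𝔓 ((Ideal.span {a}).map (algebraMap (𝓞 K) (𝓞 L)) * Ideal.span {u}) := by
    refine emultiplicity_le_emultiplicity_of_dvd_right ?_
    rw [Ideal.dvd_iff_le, Ideal.map_span, Set.image_singleton,
      Ideal.span_singleton_mul_span_singleton, Ideal.span_singleton_le_iff_mem]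
    exact h
  have h2 : emultiplicity 𝔓 (Ideal.span {u}) = 0 := by
    rw [emultiplicity_eq_zero, Ideal.dvd_span_singleton]
    exact hu
  rw [emultiplicity_mul hP, h2, add_zero,
    Ideal.IsDedekindDomain.emultiplicity_map_eq_ramificationIdx'_mul
      (pow_ne_zero c h𝔮) hq hP.irreducible h𝔓,
    Ideal.IsDedekindDomain.emultiplicity_map_eq_ramificationIdx'_mul
      (by simpa using ha) hq hP.irreducible h𝔓,
    ENat.mul_le_mul_left_iff (by exact_mod_cast he) (ENat.natCast_ne_top _),
    emultiplicity_pow_self h𝔮 hq.not_isUnit, ← pow_dvd_iff_le_emultiplicity,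
    Ideal.dvd_span_singleton] at h1
  exact h1

variable {F k : Type*} [Field F] [Fintype F] [Field k]
variable {p q : ℕ} [Fact p.Prime] [Fact q.Prime] [Algebra (ZMod q) F] [IsGalois ℚ L]

/-- The `p`-th power of the Gauss sum of a character of order `p` lies in `K`, and the Galois
group of `K` permutes these powers. -/
theorem exists_algebraMap_eq_neg_gaussSum_pow (hp2 : p ≠ 2) {ζ : 𝓞 K} (hζ : IsPrimitiveRoot ζ p)
    {χ : MulChar F (𝓞 L)} (hχ : χ ^ p = 1) {η : 𝓞 L} (hη : IsPrimitiveRoot η q) :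
    ∃ G : 𝓞 K,
      algebraMap (𝓞 K) (𝓞 L) G = (-gaussSum χ (traceAddChar q F hη.pow_eq_one)) ^ p ∧
      ∀ (s : Gal(K/ℚ)) (a : ℕ), a ≠ 0 → s • ζ = ζ ^ a →
        algebraMap (𝓞 K) (𝓞 L) (s • G) =
          (-gaussSum (χ ^ a) (traceAddChar q F hη.pow_eq_one)) ^ p := by
  have hodd : Odd p := (Fact.out : p.Prime).odd_of_ne_two hp2
  have hgal : IsGalois K L := IsGalois.tower_top_of_isGalois ℚ K L
  have hζL : IsPrimitiveRoot (algebraMap (𝓞 K) (𝓞 L) ζ) p :=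
    hζ.map_of_injective (FaithfulSMul.algebraMap_injective (𝓞 K) (𝓞 L))
  have hinj : ∀ t : L →+* L, Function.Injective (NumberField.RingOfIntegers.mapRingHom t) := by
    intro t x y hxy
    apply NumberField.RingOfIntegers.ext
    apply t.injective
    exact congrArg (fun z : 𝓞 L => (z : L)) hxy
  obtain ⟨G, hG⟩ : ∃ G : 𝓞 K,
      algebraMap (𝓞 K) (𝓞 L) G = gaussSum χ (traceAddChar q F hη.pow_eq_one) ^ p := by
    obtain ⟨y, hy⟩ := (IsGalois.mem_range_algebraMap_iff_fixed (F := K)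
      ((gaussSum χ (traceAddChar q F hη.pow_eq_one) ^ p : 𝓞 L) : L)).2 (by
        intro t
        have h1 := map_gaussSum_pow hχ hζL hη
          (NumberField.RingOfIntegers.mapRingHom (t : L →+* L)) (hinj _) one_ne_zero (by
            rw [pow_one]
            apply NumberField.RingOfIntegers.ext
            exact t.commutes (ζ : K))
        rw [pow_one] at h1
        exact congrArg (fun z : 𝓞 L => (z : L)) h1)
    have hint : IsIntegral ℤ y := by
      rw [← isIntegral_algebraMap_iff (algebraMap K L).injective, hy]
      exact NumberField.RingOfIntegers.isIntegral_coe _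
    exact ⟨⟨y, hint⟩, NumberField.RingOfIntegers.ext hy⟩
  refine ⟨-G, by rw [map_neg, hG, hodd.neg_pow], fun s a ha hs => ?_⟩
  have h1 := map_gaussSum_pow hχ hζL hη
    (NumberField.RingOfIntegers.mapRingHom ((s.liftNormal L : Gal(L/ℚ)) : L →+* L)) (hinj _) ha (by
      rw [← map_pow, ← hs]
      apply NumberField.RingOfIntegers.ext
      exact s.liftNormal_commutes L (ζ : K))
  rw [hodd.neg_pow, ← h1, ← hG, smul_neg, map_neg]
  congr 1
  apply NumberField.RingOfIntegers.ext
  exact (s.liftNormal_commutes L (G : K)).symm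

end Descent

/-! ### The Stickelberger element attached to a prime ideal -/

section StickelbergerElement

variable {K L : Type*} [Field K] [NumberField K] [Field L] [NumberField L] [Algebra K L]
variable {F k : Type*} [Field F] [Fintype F] [Field k]
variable {p q f M : ℕ} [Fact p.Prime] [Fact q.Prime] [Algebra (ZMod q) F] [IsGalois ℚ L]

/-- The `p`-th power `G` of (the negative of) a Gauss sum of order `p` over `F`, computed in an
auxiliary field `L` that contains the roots of unity of order `q` and `|F| - 1`. Here `F` is any
finite field with an embedding `ι` into a residue field of `L` at a prime `𝔓` above `𝔮`; a different
choice of `ι` changes the Teichmüller character by a power of the Frobenius map, which does not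
affect the exponents. -/
theorem exists_stickelberger_element_of_residue (hp2 : p ≠ 2) {ζ : 𝓞 K} (hζ : IsPrimitiveRoot ζ p)
    (hunitK : ¬ IsUnit (ζ - 1))
    (𝔮 : Ideal (𝓞 K)) [𝔮.IsPrime] (h𝔮 : 𝔮 ≠ ⊥) (hq𝔮 : (q : 𝓞 K) ∈ 𝔮)
    (𝔓 : Ideal (𝓞 L)) [𝔓.IsPrime] [𝔓.LiesOver 𝔮]
    (red : 𝓞 L →+* k) (hred : ∀ x ∈ 𝔓, red x = 0) (ι : F →+* k)
    (hF : Fintype.card F = q ^ f) (hM : p * M = q ^ f - 1) (hF2 : 2 < Fintype.card F)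
    (hpF : (p : F) ≠ 0) {η θ : 𝓞 L} (hη : IsPrimitiveRoot η q)
    (hθ : IsPrimitiveRoot θ (Fintype.card F - 1)) :
    ∃ G : 𝓞 K,
      (∀ φ : K →+* ℂ, ‖φ G‖ ^ 2 = ((q ^ f : ℕ) : ℝ) ^ p) ∧
      (∀ (s : Gal(K/ℚ)) (x : ZMod p), x ≠ 0 → s • ζ = ζ ^ x.val →
        s • G ∈ 𝔮 ^ ∑ j ∈ Finset.range f, (q ^ j * x : ZMod p).val) ∧
      ∃ i : ℕ, (p ∣ i ↔ (p : F) ^ M = 1) ∧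
        ∀ e : ℕ, ∃ r : 𝓞 K, (G ^ p) ^ e = 1 + (ζ - 1) ^ (2 * p - 1) * (e * i + (ζ - 1) * r) := by
  have hp : p.Prime := Fact.out
  have hqp : q.Prime := Fact.out
  have hinj : Function.Injective (algebraMap (𝓞 K) (𝓞 L)) :=
    FaithfulSMul.algebraMap_injective (𝓞 K) (𝓞 L)
  have hζL : IsPrimitiveRoot (algebraMap (𝓞 K) (𝓞 L) ζ) p := hζ.map_of_injective hinj
  obtain ⟨ω, hω⟩ := exists_mulChar_lift red ι hθ
  have hM0 : M ≠ 0 := by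
    rintro rfl
    omega
  have hqf : (q ^ f : ZMod p) = 1 := by
    have h1 : q ^ f = p * M + 1 := by
      have := Nat.one_le_pow f q hqp.pos
      omega
    have h2 := congrArg (Nat.cast (R := ZMod p)) h1
    push_cast at h2
    rwa [CharP.cast_eq_zero (ZMod p) p, zero_mul, zero_add] at h2
  have hχ : (ω⁻¹ ^ M) ^ p = 1 := mulChar_pow_pow_eq_one hF hM _
  have hχ1 : ω⁻¹ ^ M ≠ 1 := by
    refine pow_ne_one_of_lt_orderOf hM0 ?_
    have : Fact (1 < p) := ⟨hp.one_lt⟩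
    have h1 := mul_val_lt_orderOf_inv hF hF2 hω hM (1 : ZMod p)
    rwa [ZMod.val_one, mul_one] at h1
  obtain ⟨G, hG, hGs⟩ := exists_algebraMap_eq_neg_gaussSum_pow (K := K) hp2 hζ hχ hη
  refine ⟨G, fun φ => ?_, fun s x hx hs => ?_, ?_⟩
  · set Φ := (NumberField.ComplexEmbedding.lift L φ).comp (algebraMap (𝓞 L) L) with hΦ
    have hΦinj : Function.Injective Φ :=
      (NumberField.ComplexEmbedding.lift L φ).injective.comp
        (FaithfulSMul.algebraMap_injective (𝓞 L) L)
    have h1 := norm_gaussSum_sq Φ hΦinj hχ1 hη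
    have h2 : φ G = Φ (algebraMap (𝓞 K) (𝓞 L) G) :=
      (NumberField.ComplexEmbedding.lift_algebraMap_apply L φ (G : K)).symm
    rw [h2, hG, map_pow, norm_pow, map_neg, norm_neg, ← pow_mul, mul_comm p 2, pow_mul, h1, hF]
  · have hx0 : x.val ≠ 0 := by rwa [Ne, ZMod.val_eq_zero]
    have hodd : Odd p := hp.odd_of_ne_two hp2
    obtain ⟨u, y, hu, h⟩ := exists_gaussSum_pow_mul_unit_eq hF hF2 red ι ω hω hη hqf hM hp2
      (by exact_mod_cast hqp.ne_zero) hx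
    refine Ideal.mem_pow_of_algebraMap_mul_mem 𝔮 h𝔮 𝔓 (u := u)
      (c := ∑ j ∈ Finset.range f, (q ^ j * x : ZMod p).val) ?_ ?_
    · exact fun h => hu (hred u h)
    · rw [hGs s x.val hx0 hs, hodd.neg_pow, neg_mul, h]
      refine neg_mem (Ideal.mul_mem_left _ _ ?_)
      rw [← map_natCast (algebraMap (𝓞 K) (𝓞 L)), ← map_pow]
      exact Ideal.mem_map_of_mem _ (Ideal.pow_mem_pow hq𝔮 _)
  · have : NeZero p := ⟨hp.ne_zero⟩
    obtain ⟨i, -, hi⟩ := MulChar.exists_apply_eq_pow hχ hζL hpF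
    have hunit : ¬ IsUnit (algebraMap (𝓞 K) (𝓞 L) ζ - 1) := by
      rw [isUnit_iff_dvd_one]
      intro hu
      refine hunitK (isUnit_iff_dvd_one.2
        (NumberField.RingOfIntegers.dvd_of_algebraMap_dvd (L := L) ?_))
      rwa [map_sub, map_one]
    refine ⟨i, ?_, fun e => ?_⟩
    · have hι1 : ∀ y : F, ω y = 1 ↔ y = 1 := by
        intro y
        refine ⟨fun h => ι.injective ?_, fun h => by rw [h, map_one]⟩
        rw [← hω, h, map_one, map_one]
      rw [← hζL.pow_eq_one_iff_dvd, ← hi, MulChar.pow_apply' _ hM0, MulChar.inv_apply',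
        ← map_pow, hι1, inv_pow, inv_eq_one]
    · obtain ⟨r, hr⟩ := exists_neg_gaussSum_pow_eq hζL hunit hχ hη hpF hi hp2 e
      have hpow : (ζ - 1) ^ (2 * p - 1) * (ζ - 1) = (ζ - 1) ^ (2 * p) := by
        rw [← pow_succ]
        congr 1
        have := hp.two_le
        omega
      have hdvd : (ζ - 1) ^ (2 * p - 1) * (ζ - 1) ∣
          (G ^ p) ^ e - 1 - (ζ - 1) ^ (2 * p - 1) * (e * i) := by
        refine NumberField.RingOfIntegers.dvd_of_algebraMap_dvd (L := L) ⟨r, ?_⟩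
        simp only [map_sub, map_mul, map_pow, map_one, map_natCast, hG, hr]
        ring
      obtain ⟨r', hr'⟩ := hdvd
      refine ⟨r', ?_⟩
      linear_combination hr'

end StickelbergerElement

section StickelbergerElementCyclotomic

theorem isGalois_rat_of_isCyclotomicExtension {K L : Type*} [Field K] [NumberField K] [Field L]
    [NumberField L] [Algebra K L] (m n : ℕ) [IsCyclotomicExtension {m} ℚ K]
    [IsCyclotomicExtension {n} K L] : IsGalois ℚ L := by
  have := IsCyclotomicExtension.trans {m} {n} ℚ K L (algebraMap K L).injective
  exact IsCyclotomicExtension.isGalois ({m} ∪ {n}) ℚ L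

variable {p q : ℕ} [Fact p.Prime] [Fact q.Prime] {K : Type*} [Field K] [NumberField K]

omit [Fact q.Prime] [NumberField K] in
theorem natCast_mem_of_liesOver (𝔮 : Ideal (𝓞 K)) [𝔮.LiesOver (Ideal.span {(q : ℤ)})] :
    (q : 𝓞 K) ∈ 𝔮 := by
  have h := (Ideal.mem_of_liesOver 𝔮 (Ideal.span {(q : ℤ)}) (q : ℤ)).1
    (Ideal.mem_span_singleton_self _)
  simpa using h

theorem ne_bot_of_liesOver_span_natCast (𝔮 : Ideal (𝓞 K)) [𝔮.LiesOver (Ideal.span {(q : ℤ)})] :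
    𝔮 ≠ ⊥ := by
  rintro rfl
  have h := natCast_mem_of_liesOver (q := q) (⊥ : Ideal (𝓞 K))
  rw [Ideal.mem_bot] at h
  exact (Fact.out : q.Prime).ne_zero (by exact_mod_cast h)

theorem natCast_notMem_of_liesOver (hqp : q ≠ p) (𝔮 : Ideal (𝓞 K)) [𝔮.IsPrime]
    [𝔮.LiesOver (Ideal.span {(q : ℤ)})] : (p : 𝓞 K) ∉ 𝔮 := by
  intro h
  have hcop : IsCoprime (q : ℤ) (p : ℤ) :=
    Nat.isCoprime_iff_coprime.2 ((Nat.coprime_primes Fact.out Fact.out).2 hqp)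
  obtain ⟨a, b, hab⟩ := hcop
  refine (Ideal.ne_top_iff_one 𝔮).1 ‹𝔮.IsPrime›.ne_top ?_
  have h1 : (1 : 𝓞 K) = a * q + b * p := by exact_mod_cast congrArg (Int.cast (R := 𝓞 K)) hab.symm
  rw [h1]
  exact add_mem (Ideal.mul_mem_left _ _ (natCast_mem_of_liesOver 𝔮)) (Ideal.mul_mem_left _ _ h)

theorem not_isUnit_sub_one [IsCyclotomicExtension {p} ℚ K] {ζ : 𝓞 K} (hζ : IsPrimitiveRoot ζ p) :
    ¬ IsUnit (ζ - 1) := by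
  have hζK : IsPrimitiveRoot (ζ : K) p :=
    hζ.map_of_injective (f := algebraMap (𝓞 K) K) (FaithfulSMul.algebraMap_injective _ _)
  exact hζK.zeta_sub_one_prime'.not_isUnit

attribute [local instance] Ideal.Quotient.field

/-- For a prime `𝔮` of residue cardinality `q ^ f` there is an algebraic integer `G` (the `p`-th
power of a Gauss sum) with `|G|² = q ^ (f p)` at every complex embedding, divisible by the
conjugates of `𝔮` as prescribed by Stickelberger's theorem, and whose expansion at `ζ - 1` detects
whether `p` is a `p`-th power modulo `𝔮`. -/
theorem exists_stickelberger_element [IsCyclotomicExtension {p} ℚ K] (hp2 : p ≠ 2) (hqp : q ≠ p)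
    {ζ : 𝓞 K} (hζ : IsPrimitiveRoot ζ p) (𝔮 : Ideal (𝓞 K)) [𝔮.IsPrime]
    [𝔮.LiesOver (Ideal.span {(q : ℤ)})] :
    ∃ (f M : ℕ) (G : 𝓞 K), Ideal.absNorm 𝔮 = q ^ f ∧ p * M = q ^ f - 1 ∧
      (∀ φ : K →+* ℂ, ‖φ G‖ ^ 2 = ((q ^ f : ℕ) : ℝ) ^ p) ∧
      (∀ (s : Gal(K/ℚ)) (x : ZMod p), x ≠ 0 → s • ζ = ζ ^ x.val →
        s • G ∈ 𝔮 ^ ∑ j ∈ Finset.range f, (q ^ j * x : ZMod p).val) ∧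
      ∃ i : ℕ, (p ∣ i ↔ (p : 𝓞 K) ^ M - 1 ∈ 𝔮) ∧
        ∀ e : ℕ, ∃ r : 𝓞 K, (G ^ p) ^ e = 1 + (ζ - 1) ^ (2 * p - 1) * (e * i + (ζ - 1) * r) := by
  have hp : p.Prime := Fact.out
  have hq : q.Prime := Fact.out
  have h𝔮 : 𝔮 ≠ ⊥ := ne_bot_of_liesOver_span_natCast (q := q) 𝔮
  have hmax : 𝔮.IsMaximal := ‹𝔮.IsPrime›.isMaximal h𝔮
  have hfin : Finite (𝓞 K ⧸ 𝔮) := Ring.HasFiniteQuotients.finiteQuotient h𝔮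
  have : Fintype (𝓞 K ⧸ 𝔮) := Fintype.ofFinite _
  have hchar : CharP (𝓞 K ⧸ 𝔮) q := by
    refine (CharP.charP_iff_prime_eq_zero hq).2 ?_
    rw [← map_natCast (Ideal.Quotient.mk 𝔮), Ideal.Quotient.eq_zero_iff_mem]
    exact natCast_mem_of_liesOver 𝔮
  let _ : Algebra (ZMod q) (𝓞 K ⧸ 𝔮) := ZMod.algebra _ q
  have hF : Fintype.card (𝓞 K ⧸ 𝔮) = q ^ Module.finrank (ZMod q) (𝓞 K ⧸ 𝔮) := by
    rw [Module.card_eq_pow_finrank (K := ZMod q), ZMod.card]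
  set f := Module.finrank (ZMod q) (𝓞 K ⧸ 𝔮)
  have hpF : (p : 𝓞 K ⧸ 𝔮) ≠ 0 := by
    rw [← map_natCast (Ideal.Quotient.mk 𝔮), Ne, Ideal.Quotient.eq_zero_iff_mem]
    exact natCast_notMem_of_liesOver hqp 𝔮
  have hord : orderOf (Ideal.Quotient.mk 𝔮 ζ) = p := by
    refine orderOf_eq_prime (by rw [← map_pow, hζ.pow_eq_one, map_one]) ?_
    rw [← map_one (Ideal.Quotient.mk 𝔮), Ne, Ideal.Quotient.mk_eq_mk_iff_sub_mem]
    intro h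
    obtain ⟨z, -, hz⟩ := hζ.self_sub_one_pow_dvd_order hp.one_lt
    refine natCast_notMem_of_liesOver (q := q) hqp 𝔮 ?_
    rw [hz, pow_one]
    exact Ideal.mul_mem_left _ _ h
  have hdvd : p ∣ Fintype.card (𝓞 K ⧸ 𝔮) - 1 := by
    rw [← hord]
    refine orderOf_dvd_of_pow_eq_one (FiniteField.pow_card_sub_one_eq_one _ ?_)
    intro h0
    have h1 := congrArg (Ideal.Quotient.mk 𝔮) hζ.pow_eq_one
    rw [map_pow, h0, zero_pow hp.ne_zero, map_one] at h1
    exact zero_ne_one h1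
  have hcard1 : 1 < Fintype.card (𝓞 K ⧸ 𝔮) := Fintype.one_lt_card
  have hF2 : 2 < Fintype.card (𝓞 K ⧸ 𝔮) := by
    have h1 := Nat.le_of_dvd (by omega) hdvd
    have := hp.two_le
    omega
  obtain ⟨M, hM⟩ := hdvd
  rw [hF] at hM
  -- the auxiliary field containing the roots of unity of order `q` and `q ^ f - 1`
  set n := q * (Fintype.card (𝓞 K ⧸ 𝔮) - 1) with hn
  have hn0 : 0 < n := Nat.mul_pos hq.pos (by omega)
  have : NeZero n := ⟨hn0.ne'⟩
  have hGal : IsGalois ℚ (CyclotomicField n K) := isGalois_rat_of_isCyclotomicExtension p n (K := K)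
  have hξ := (IsCyclotomicExtension.zeta_spec n K (CyclotomicField n K)).toInteger_isPrimitiveRoot
  have hη := hξ.pow hn0 (a := Fintype.card (𝓞 K ⧸ 𝔮) - 1) (b := q) (by rw [hn, mul_comm])
  have hθ := hξ.pow hn0 (a := q) (b := Fintype.card (𝓞 K ⧸ 𝔮) - 1) hn
  obtain ⟨𝔓, h𝔓, hover⟩ :=
    Ideal.exists_maximal_ideal_liesOver_of_isIntegral (S := 𝓞 (CyclotomicField n K)) 𝔮
  obtain ⟨G, h1, h2, i, hi, h3⟩ := exists_stickelberger_element_of_residue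
    (F := 𝓞 K ⧸ 𝔮) (k := 𝓞 (CyclotomicField n K) ⧸ 𝔓) hp2 hζ (not_isUnit_sub_one hζ) 𝔮 h𝔮
    (natCast_mem_of_liesOver 𝔮) 𝔓 (Ideal.Quotient.mk 𝔓)
    (fun x hx => Ideal.Quotient.eq_zero_iff_mem.2 hx)
    (@algebraMap _ _ _ _ (Ideal.Quotient.algebraOfLiesOver 𝔓 𝔮)) hF hM.symm hF2 hpF hη hθ
  refine ⟨f, M, G, ?_, hM.symm, h1, h2, i, ?_, h3⟩
  · rw [Ideal.absNorm_apply, Submodule.cardQuot_apply, Nat.card_eq_fintype_card, ← hF]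
  · rw [hi, ← Ideal.Quotient.eq_zero_iff_mem, map_sub, map_pow, map_natCast, map_one, sub_eq_zero]

end StickelbergerElementCyclotomic

/-! ### The action of the Stickelberger element on numbers and ideals -/

section StickelbergerAction

open IsCyclotomicExtension.Rat
open scoped Pointwise

variable {p : ℕ} [Fact p.Prime] {K : Type*} [Field K] [NumberField K]
  [IsCyclotomicExtension {p} ℚ K]

theorem galEquivZMod_eq_of_smul_eq {ζ : 𝓞 K} (hζ : IsPrimitiveRoot ζ p) {s : Gal(K/ℚ)}
    {u : (ZMod p)ˣ} (hs : s • ζ = ζ ^ (u : ZMod p).val) : galEquivZMod p K s = u := by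
  rw [galEquivZMod_smul_of_pow_eq p K s hζ.pow_eq_one] at hs
  exact Units.ext (ZMod.val_injective p (hζ.pow_inj (ZMod.val_lt _) (ZMod.val_lt _) hs))

/-- The product defining `A ^ P(σ)` does not depend on the generator: it runs over the Galois
group, the exponent of `s` being the residue of the inverse of its cyclotomic character. -/
theorem stickelbergerPow_eq_prod_gal {ζ : 𝓞 K} (hζ : IsPrimitiveRoot ζ p) {v : (ZMod p)ˣ}
    (hv : ∀ x : (ZMod p)ˣ, x ∈ Subgroup.zpowers v) {σ : Gal(K/ℚ)}
    (hσ : σ • ζ = ζ ^ (v : ZMod p).val) (A : 𝓞 K) :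
    stickelbergerPow v σ A =
      ∏ s : Gal(K/ℚ), (s • A) ^ ((galEquivZMod p K s)⁻¹ : (ZMod p)ˣ).val.val := by
  classical
  have hκ : galEquivZMod p K σ = v := galEquivZMod_eq_of_smul_eq hζ hσ
  have hord : orderOf v = p - 1 := by
    rw [orderOf_eq_card_of_forall_mem_zpowers hv, Nat.card_eq_fintype_card, ZMod.card_units]
  refine Finset.prod_bij (fun i _ => σ ^ i) (fun _ _ => Finset.mem_univ _) ?_ ?_ ?_
  · intro i hi j hj hij
    have h1 := congrArg (galEquivZMod p K) hij
    rw [map_pow, map_pow, hκ] at h1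
    refine pow_injOn_Iio_orderOf ?_ ?_ h1
    · simpa [hord] using hi
    · simpa [hord] using hj
  · intro s _
    have h1 := (mem_zpowers_iff_mem_range_orderOf).1 (hv (galEquivZMod p K s))
    obtain ⟨i, hi, his⟩ := Finset.mem_image.1 h1
    refine ⟨i, hord ▸ hi, (galEquivZMod p K).injective ?_⟩
    rw [map_pow, hκ]
    exact his
  · intro i _
    rw [residuePow, map_pow, hκ, zpow_neg, zpow_natCast]

/-- The automorphism `ζ ↦ ζ⁻¹` induces complex conjugation at every embedding. -/
theorem norm_embedding_smul_of_galEquivZMod_eq_neg_one {c : Gal(K/ℚ)}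
    (hc : galEquivZMod p K c = -1) (φ : K →+* ℂ) (x : K) : ‖φ (c x)‖ = ‖φ x‖ := by
  have hp : p.Prime := Fact.out
  have hz := IsCyclotomicExtension.zeta_spec p ℚ K
  set z := IsCyclotomicExtension.zeta p ℚ K
  have hcz : c z = z⁻¹ := by
    rw [galEquivZMod_apply_of_pow_eq p K c hz.pow_eq_one, hc, Units.val_neg, Units.val_one]
    refine eq_inv_of_mul_eq_one_left ?_
    have : Fact (1 < p) := ⟨hp.one_lt⟩
    have h1 : ((-1 : ZMod p)).val + 1 = p := by
      rw [ZMod.val_neg_of_ne_zero, ZMod.val_one, Nat.sub_add_cancel hp.one_le]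
    rw [← pow_succ, h1, hz.pow_eq_one]
  have h1 : φ.comp (c : K →+* K) = (starRingEnd ℂ).comp φ := by
    have h2 : RingHom.toRatAlgHom (φ.comp (c : K →+* K)) =
        RingHom.toRatAlgHom ((starRingEnd ℂ).comp φ) := by
      refine (hz.powerBasis ℚ).algHom_ext ?_
      rw [IsPrimitiveRoot.powerBasis_gen]
      change φ (c z) = starRingEnd ℂ (φ z)
      rw [hcz, map_inv₀, ← Complex.inv_eq_conj]
      exact Complex.norm_eq_one_of_pow_eq_one (by rw [← map_pow, hz.pow_eq_one, map_one])
        hp.ne_zero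
    exact RingHom.ext fun x => DFunLike.congr_fun h2 x
  have h3 := congrArg norm (DFunLike.congr_fun h1 x)
  rw [RingHom.comp_apply, RingHom.comp_apply, RCLike.norm_conj] at h3
  exact h3

/-- Since the exponents of `s` and of its product with complex conjugation add up to `p`, all
absolute values of `A ^ P(σ)` are `N(A) ^ (p / 2)`. -/
theorem norm_prod_gal_smul_pow_sq (A : 𝓞 K) (φ : K →+* ℂ) :
    ‖φ (∏ s : Gal(K/ℚ), (s • A) ^ ((galEquivZMod p K s)⁻¹ : (ZMod p)ˣ).val.val : 𝓞 K)‖ ^ 2 =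
      (Ideal.absNorm (Ideal.span {A}) : ℝ) ^ p := by
  have hgal : IsGalois ℚ K := IsCyclotomicExtension.isGalois {p} ℚ K
  let c : Gal(K/ℚ) := (galEquivZMod p K).symm (-1)
  have hc1 : galEquivZMod p K c = -1 := (galEquivZMod p K).apply_symm_apply (-1)
  have h1 : ‖φ (∏ s : Gal(K/ℚ), (s • A) ^ ((galEquivZMod p K s)⁻¹ : (ZMod p)ˣ).val.val : 𝓞 K)‖ =
      ∏ s : Gal(K/ℚ), ‖φ (s (A : K))‖ ^ ((galEquivZMod p K s)⁻¹ : (ZMod p)ˣ).val.val := by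
    change ‖(φ.comp (algebraMap (𝓞 K) K)) _‖ = _
    rw [map_prod, norm_prod]
    refine Finset.prod_congr rfl fun s _ => ?_
    rw [map_pow, norm_pow]
    rfl
  have h2 : ∏ s : Gal(K/ℚ), ‖φ (s (A : K))‖ ^ ((galEquivZMod p K s)⁻¹ : (ZMod p)ˣ).val.val =
      ∏ s : Gal(K/ℚ), ‖φ (s (A : K))‖ ^ (p - ((galEquivZMod p K s)⁻¹ : (ZMod p)ˣ).val.val) := by
    rw [← Equiv.prod_comp (Equiv.mulLeft c)]
    refine Finset.prod_congr rfl fun s _ => ?_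
    have hne : NeZero ((galEquivZMod p K s)⁻¹ : (ZMod p)ˣ).val := ⟨Units.ne_zero _⟩
    have h4 : (galEquivZMod p K (c * s))⁻¹ = -(galEquivZMod p K s)⁻¹ := by
      rw [map_mul, hc1, neg_one_mul, inv_neg]
    rw [Equiv.coe_mulLeft, h4, Units.val_neg, ZMod.val_neg_of_ne_zero, AlgEquiv.mul_apply,
      norm_embedding_smul_of_galEquivZMod_eq_neg_one hc1]
  rw [h1, sq]
  nth_rewrite 2 [h2]
  rw [← Finset.prod_mul_distrib, Ideal.absNorm_span_singleton]
  have h3 : ∀ s : Gal(K/ℚ), ‖φ (s (A : K))‖ ^ ((galEquivZMod p K s)⁻¹ : (ZMod p)ˣ).val.val *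
      ‖φ (s (A : K))‖ ^ (p - ((galEquivZMod p K s)⁻¹ : (ZMod p)ˣ).val.val) =
      ‖φ (s (A : K))‖ ^ p := by
    intro s
    rw [← pow_add, Nat.add_sub_cancel' (ZMod.val_lt _).le]
  rw [Finset.prod_congr rfl fun s _ => h3 s, Finset.prod_pow, ← norm_prod, ← map_prod,
    ← Algebra.norm_eq_prod_automorphisms, ← Algebra.coe_norm_int]
  congr 1
  simp [Nat.cast_natAbs]

variable {q : ℕ} [Fact q.Prime]

theorem exists_lt_eq_pow_of_mem_zpowers {u x : (ZMod p)ˣ} {f : ℕ} (hf : 0 < f)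
    (hu : u ^ f = 1) (hx : x ∈ Subgroup.zpowers u) : ∃ j < f, x = u ^ j := by
  obtain ⟨n, rfl⟩ := (Submonoid.mem_powers_iff _ _).1 (mem_powers_iff_mem_zpowers.2 hx)
  exact ⟨n % f, Nat.mod_lt _ hf, pow_eq_pow_mod n hu⟩

/-- The exponent of the prime `s₀ • 𝔮` in `𝔮 ^ P(σ)` is at most the exponent provided by
Stickelberger's theorem, since the decomposition group of `𝔮` is generated by `q`. -/
theorem sum_val_fiber_le (hqp : q ≠ p) (𝔮 : Ideal (𝓞 K)) [𝔮.IsPrime]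
    [𝔮.LiesOver (Ideal.span {(q : ℤ)})] [DecidableEq (Ideal (𝓞 K))] {f : ℕ}
    (hf : 0 < f) (hqf : (q ^ f : ZMod p) = 1) (s₀ : Gal(K/ℚ)) :
    ∑ s : Gal(K/ℚ) with s • 𝔮 = s₀ • 𝔮, ((galEquivZMod p K s)⁻¹ : (ZMod p)ˣ).val.val ≤
      ∑ j ∈ Finset.range f,
        (q ^ j * ((galEquivZMod p K s₀)⁻¹ : (ZMod p)ˣ).val : ZMod p).val := by
  classical
  have hmax : 𝔮.IsMaximal :=
    ‹𝔮.IsPrime›.isMaximal (ne_bot_of_liesOver_span_natCast (q := q) 𝔮)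
  have hcop : q.Coprime p := (Nat.coprime_primes Fact.out Fact.out).2 hqp
  have huf : ZMod.unitOfCoprime q hcop ^ f = 1 := by
    refine Units.ext ?_
    rw [Units.val_pow_eq_pow_val, ZMod.coe_unitOfCoprime, hqf, Units.val_one]
  calc ∑ s : Gal(K/ℚ) with s • 𝔮 = s₀ • 𝔮, ((galEquivZMod p K s)⁻¹ : (ZMod p)ˣ).val.val
      = ∑ x ∈ Finset.image (fun s => ((galEquivZMod p K s)⁻¹ : (ZMod p)ˣ).val)
          {s : Gal(K/ℚ) | s • 𝔮 = s₀ • 𝔮}, x.val := by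
        rw [Finset.sum_image]
        intro s _ t _ hst
        exact (galEquivZMod p K).injective (inv_injective (Units.ext hst))
    _ ≤ ∑ x ∈ Finset.image (fun j => (q ^ j * ((galEquivZMod p K s₀)⁻¹ : (ZMod p)ˣ).val : ZMod p))
          (Finset.range f), x.val := by
        refine Finset.sum_le_sum_of_subset ?_
        intro x hx
        obtain ⟨s, hs, rfl⟩ := Finset.mem_image.1 hx
        have hs' : s • 𝔮 = s₀ • 𝔮 := (Finset.mem_filter.1 hs).2
        have hstab : s⁻¹ * s₀ ∈ MulAction.stabilizer Gal(K/ℚ) 𝔮 := by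
          rw [MulAction.mem_stabilizer_iff, mul_smul, ← hs', inv_smul_smul]
        obtain ⟨j, hj, hjs⟩ := exists_lt_eq_pow_of_mem_zpowers hf huf
          (mem_zpowers_galEquivZMod_of_mem_stabilizer p K q 𝔮 hcop hstab)
        refine Finset.mem_image.2 ⟨j, Finset.mem_range.2 hj, ?_⟩
        have h1 : (galEquivZMod p K s)⁻¹ =
            ZMod.unitOfCoprime q hcop ^ j * (galEquivZMod p K s₀)⁻¹ := by
          rw [← hjs, map_mul, map_inv, mul_inv_cancel_right]
        rw [h1, Units.val_mul, Units.val_pow_eq_pow_val, ZMod.coe_unitOfCoprime]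
    _ ≤ _ := Finset.sum_image_le_of_nonneg fun _ _ => Nat.zero_le _

/-- The divisibility `𝔮 ^ P(σ) ∣ (G)`, obtained by collecting the factors that belong to the same
conjugate of `𝔮`. -/
theorem prod_gal_smul_pow_dvd_span (hqp : q ≠ p) {ζ : 𝓞 K} (hζ : IsPrimitiveRoot ζ p)
    (𝔮 : Ideal (𝓞 K)) [𝔮.IsPrime] [𝔮.LiesOver (Ideal.span {(q : ℤ)})] {f : ℕ} (hf : 0 < f)
    (hqf : (q ^ f : ZMod p) = 1) {G : 𝓞 K}
    (hG : ∀ (s : Gal(K/ℚ)) (x : ZMod p), x ≠ 0 → s • ζ = ζ ^ x.val →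
      s • G ∈ 𝔮 ^ ∑ j ∈ Finset.range f, (q ^ j * x : ZMod p).val) :
    ∏ s : Gal(K/ℚ), (s • 𝔮) ^ ((galEquivZMod p K s)⁻¹ : (ZMod p)ˣ).val.val ∣ Ideal.span {G} := by
  classical
  have h𝔮 := ne_bot_of_liesOver_span_natCast (q := q) 𝔮
  have hmax : 𝔮.IsMaximal := ‹𝔮.IsPrime›.isMaximal h𝔮
  have hsmax : ∀ s : Gal(K/ℚ), (s • 𝔮).IsMaximal := by
    intro s
    have hne : s • 𝔮 ≠ ⊥ := by
      intro h
      refine h𝔮 ?_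
      rw [← inv_smul_smul s 𝔮, h, Ideal.smul_bot]
    exact Ideal.IsPrime.isMaximal inferInstance hne
  rw [← Finset.prod_fiberwise_of_maps_to (t := Finset.univ.image fun s : Gal(K/ℚ) => s • 𝔮)
    (fun s _ => Finset.mem_image_of_mem _ (Finset.mem_univ s))]
  refine Finset.prod_dvd_of_coprime ?_ ?_
  · intro I hI J hJ hIJ
    obtain ⟨s, -, rfl⟩ := Finset.mem_image.1 hI
    obtain ⟨t, -, rfl⟩ := Finset.mem_image.1 hJ
    have := hsmax s
    have := hsmax t
    rw [Function.onFun]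
    refine IsCoprime.prod_left fun a ha => IsCoprime.prod_right fun b hb => ?_
    rw [(Finset.mem_filter.1 ha).2, (Finset.mem_filter.1 hb).2]
    exact (Ideal.isCoprime_of_isMaximal hIJ).pow
  · intro I hI
    obtain ⟨s₀, -, rfl⟩ := Finset.mem_image.1 hI
    rw [Finset.prod_congr rfl fun a ha => by rw [(Finset.mem_filter.1 ha).2],
      Finset.prod_pow_eq_pow_sum]
    refine (pow_dvd_pow _ (sum_val_fiber_le hqp 𝔮 hf hqf s₀)).trans ?_
    rw [Ideal.dvd_span_singleton, ← smul_pow', Ideal.mem_pointwise_smul_iff_inv_smul_mem]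
    refine hG s₀⁻¹ _ (Units.ne_zero _) ?_
    rw [galEquivZMod_smul_of_pow_eq p K s₀⁻¹ hζ.pow_eq_one, map_inv]

end StickelbergerAction

/-! ### Comparison of `A ^ P(σ)` with the Gauss sum -/

section Comparison

open IsCyclotomicExtension.Rat
open scoped Pointwise

variable {p : ℕ} [Fact p.Prime] {K : Type*} [Field K] [NumberField K]
  [IsCyclotomicExtension {p} ℚ K]

theorem sub_one_dvd_intCast_iff {ζ : 𝓞 K} (hζ : IsPrimitiveRoot ζ p) (n : ℤ) :
    ζ - 1 ∣ (n : 𝓞 K) ↔ (p : ℤ) ∣ n := by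
  have hp : p.Prime := Fact.out
  obtain ⟨z, -, hz⟩ := hζ.self_sub_one_pow_dvd_order hp.one_lt
  rw [pow_one] at hz
  have hdvd : ζ - 1 ∣ ((p : ℤ) : 𝓞 K) := ⟨z, by rw [Int.cast_natCast, hz, mul_comm]⟩
  refine ⟨fun h => ?_, fun ⟨m, hm⟩ => by rw [hm, Int.cast_mul]; exact hdvd.mul_right _⟩
  by_contra hn
  obtain ⟨a, b, hab⟩ :=
    ((Nat.prime_iff_prime_int.1 hp).irreducible.coprime_iff_not_dvd (n := n)).2 hn
  refine not_isUnit_sub_one hζ (isUnit_iff_dvd_one.2 ?_)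
  have h1 : (1 : 𝓞 K) = a * ((p : ℤ) : 𝓞 K) + b * n := by
    exact_mod_cast congrArg (Int.cast (R := 𝓞 K)) hab.symm
  have h2 : ζ - 1 ∣ a * ((p : ℤ) : 𝓞 K) + b * n := dvd_add (hdvd.mul_left _) (h.mul_left _)
  rwa [← h1] at h2

theorem sub_one_sq_dvd_smul_sub {ζ : 𝓞 K} (hζ : IsPrimitiveRoot ζ p) {A : 𝓞 K} {a : ℕ}
    (hA : (ζ - 1) ^ 2 ∣ A - a) (s : Gal(K/ℚ)) : (ζ - 1) ^ 2 ∣ s • A - a := by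
  obtain ⟨b, hb⟩ := hA
  have h1 : s • A - a = (s • ζ - 1) ^ 2 * s • b := by
    have h2 := congrArg (MulSemiringAction.toRingHom Gal(K/ℚ) (𝓞 K) s) hb
    rwa [map_sub, map_natCast, map_mul, map_pow, map_sub, map_one] at h2
  rw [h1, galEquivZMod_smul_of_pow_eq p K s hζ.pow_eq_one]
  exact (pow_dvd_pow_of_dvd (sub_one_dvd_pow_sub_one _ _) 2).mul_right _

/-- If a root of unity `w` of `K` becomes `1` modulo `(ζ - 1) ^ 2` after multiplication by some
integer, then `w = ±1`. -/
theorem eq_one_or_neg_one_of_sub_one_sq_dvd (hp2 : p ≠ 2) {ζ : 𝓞 K} (hζ : IsPrimitiveRoot ζ p)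
    {w : 𝓞 K} (hw : IsOfFinOrder (w : K)) {b : ℤ} (hb : (ζ - 1) ^ 2 ∣ w * b - 1) :
    w = 1 ∨ w = -1 := by
  have hp : p.Prime := Fact.out
  have hsub0 : ζ - 1 ≠ 0 := hζ.sub_one_ne_zero hp.one_lt
  have hζK : IsPrimitiveRoot (ζ : K) p :=
    hζ.map_of_injective (f := algebraMap (𝓞 K) K) (FaithfulSMul.algebraMap_injective _ _)
  obtain ⟨r, -, hr⟩ := hζK.exists_pow_or_neg_mul_pow_of_isOfFinOrder (hp.odd_of_ne_two hp2) hw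
  obtain ⟨ε, hε, hwε⟩ : ∃ ε : ℤ, (ε = 1 ∨ ε = -1) ∧ w = ε * ζ ^ r := by
    rcases hr with hr | hr
    · exact ⟨1, Or.inl rfl, NumberField.RingOfIntegers.ext (by simpa using hr)⟩
    · exact ⟨-1, Or.inr rfl, NumberField.RingOfIntegers.ext (by simpa using hr)⟩
  obtain ⟨t, ht⟩ : ∃ t, ζ ^ r = 1 + (ζ - 1) * r + (ζ - 1) ^ 2 * t := by
    obtain ⟨t, ht⟩ := exists_eq_add_mul_of_mk_eq
      ((mk_geom_sum ζ r).trans (map_natCast (Ideal.Quotient.mk (Ideal.span {ζ - 1})) r).symm)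
    refine ⟨t, ?_⟩
    have h1 := geom_sum_mul ζ r
    rw [ht] at h1
    linear_combination -h1
  have hb' : (ζ - 1) ^ 2 ∣ ((ε * b - 1 : ℤ) : 𝓞 K) + (ζ - 1) * ((ε * b * r : ℤ) : 𝓞 K) := by
    have h1 : w * b - 1 = ((ε * b - 1 : ℤ) : 𝓞 K) + (ζ - 1) * ((ε * b * r : ℤ) : 𝓞 K) +
        (ζ - 1) ^ 2 * (ε * b * t) := by
      rw [hwε, ht]
      push_cast
      ring
    rw [h1] at hb
    exact (dvd_add_left (dvd_mul_right _ _)).1 hb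
  have hdvd1 : (p : ℤ) ∣ ε * b - 1 := by
    rw [← sub_one_dvd_intCast_iff hζ]
    exact (dvd_add_left (dvd_mul_right _ _)).1 ((dvd_pow_self _ two_ne_zero).trans hb')
  have hsq : (ζ - 1) ^ 2 ∣ ((ε * b - 1 : ℤ) : 𝓞 K) := by
    obtain ⟨m, hm⟩ := hdvd1
    obtain ⟨z, -, hz⟩ := hζ.self_sub_one_pow_dvd_order (k := 2)
      (by have := hp.two_le; omega)
    rw [hm, Int.cast_mul, Int.cast_natCast, hz]
    exact (dvd_mul_left _ _).mul_right _
  have hdvd2 : (p : ℤ) ∣ ε * b * r := by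
    rw [← sub_one_dvd_intCast_iff hζ, ← mul_dvd_mul_iff_left hsub0, ← sq]
    exact (dvd_add_right hsq).1 hb'
  have hpr : (p : ℤ) ∣ r := by
    refine ((Nat.prime_iff_prime_int.1 hp).dvd_or_dvd hdvd2).resolve_left fun h => ?_
    have h1 := dvd_sub h hdvd1
    rw [sub_sub_cancel] at h1
    exact (Nat.prime_iff_prime_int.1 hp).not_dvd_one h1
  have hζr : ζ ^ r = 1 := (hζ.pow_eq_one_iff_dvd r).2 (Int.natCast_dvd_natCast.1 hpr)
  rw [hwε, hζr, mul_one]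
  rcases hε with rfl | rfl
  · exact Or.inl (by simp)
  · exact Or.inr (by simp)

theorem span_prod_gal_smul_pow {A : 𝓞 K} {𝔮 : Ideal (𝓞 K)} {m : ℕ}
    (hA : Ideal.span {A} = 𝔮 ^ m) (n : Gal(K/ℚ) → ℕ) :
    Ideal.span {∏ s : Gal(K/ℚ), (s • A) ^ n s} = (∏ s : Gal(K/ℚ), (s • 𝔮) ^ n s) ^ m := by
  rw [← Ideal.prod_span_singleton, ← Finset.prod_pow]
  refine Finset.prod_congr rfl fun s _ => ?_
  have h1 : Ideal.span {s • A} = s • Ideal.span {A} := by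
    rw [Ideal.pointwise_smul_def, Ideal.map_span, Set.image_singleton]
    rfl
  rw [← Ideal.span_singleton_pow, h1, hA, smul_pow', ← pow_mul, ← pow_mul, mul_comm]

variable {q : ℕ} [Fact q.Prime]

/-- When `𝔮 ^ (e p)` is generated by a semi-primary `A`, the number `A ^ P(σ)` is, up to sign, the
power `G ^ (p e)` of the Stickelberger element: both have the same divisor and the same absolute
values, and both are congruent to integers modulo `(ζ - 1) ^ 2`. -/
theorem exists_sign_mul_stickelbergerPow_eq (hp2 : p ≠ 2) (hqp : q ≠ p) {ζ : 𝓞 K}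
    (hζ : IsPrimitiveRoot ζ p) {v : (ZMod p)ˣ} (hv : ∀ x : (ZMod p)ˣ, x ∈ Subgroup.zpowers v)
    {σ : Gal(K/ℚ)} (hσ : σ • ζ = ζ ^ (v : ZMod p).val) (𝔮 : Ideal (𝓞 K)) [𝔮.IsPrime]
    [𝔮.LiesOver (Ideal.span {(q : ℤ)})] {A : 𝓞 K} (hsemi : IsSemiPrimary p ζ A) {e : ℕ}
    (hA : Ideal.span {A} = 𝔮 ^ (p * e)) {f M : ℕ} {G : 𝓞 K} (hf : Ideal.absNorm 𝔮 = q ^ f)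
    (hM : p * M = q ^ f - 1)
    (hnorm : ∀ φ : K →+* ℂ, ‖φ G‖ ^ 2 = ((q ^ f : ℕ) : ℝ) ^ p)
    (hG : ∀ (s : Gal(K/ℚ)) (x : ZMod p), x ≠ 0 → s • ζ = ζ ^ x.val →
      s • G ∈ 𝔮 ^ ∑ j ∈ Finset.range f, (q ^ j * x : ZMod p).val)
    (hG1 : (ζ - 1) ^ 2 ∣ (G ^ p) ^ e - 1) :
    ∃ δ : ℤ, (δ = 1 ∨ δ = -1) ∧ stickelbergerPow v σ A = δ * (G ^ p) ^ e := by
  have hq : q.Prime := Fact.out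
  rw [stickelbergerPow_eq_prod_gal hζ hv hσ]
  set B : 𝓞 K := ∏ s : Gal(K/ℚ), (s • A) ^ ((galEquivZMod p K s)⁻¹ : (ZMod p)ˣ).val.val with hB
  have h1 : 1 ≤ q ^ f := Nat.one_le_pow f q hq.pos
  have hf0 : 0 < f := by
    refine Nat.pos_of_ne_zero ?_
    rintro rfl
    refine ‹𝔮.IsPrime›.ne_top (Ideal.absNorm_eq_one_iff.1 ?_)
    rw [hf, pow_zero]
  have hqf : (q ^ f : ZMod p) = 1 := by
    have h2 : q ^ f = p * M + 1 := by omega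
    have h3 := congrArg (Nat.cast (R := ZMod p)) h2
    push_cast at h3
    rwa [CharP.cast_eq_zero (ZMod p) p, zero_mul, zero_add] at h3
  have hdvd : B ∣ (G ^ p) ^ e := by
    rw [← Ideal.span_singleton_le_span_singleton, ← Ideal.dvd_iff_le, span_prod_gal_smul_pow hA,
      ← pow_mul, ← Ideal.span_singleton_pow]
    exact pow_dvd_pow_of_dvd (prod_gal_smul_pow_dvd_span hqp hζ 𝔮 hf0 hqf hG) _
  obtain ⟨w, hw⟩ := hdvd
  have hwnorm : ∀ φ : K →+* ℂ, ‖φ w‖ = 1 := by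
    intro φ
    have hBn : ‖φ B‖ ^ 2 = (((q ^ f : ℕ) : ℝ) ^ p) ^ (p * e) := by
      rw [norm_prod_gal_smul_pow_sq, hA, map_pow, hf, Nat.cast_pow, ← pow_mul, ← pow_mul,
        mul_comm p (p * e)]
    have hGn : ‖φ (((G ^ p) ^ e : 𝓞 K) : K)‖ ^ 2 = (((q ^ f : ℕ) : ℝ) ^ p) ^ (p * e) := by
      rw [← hnorm φ, ← pow_mul G]
      simp only [map_pow, norm_pow]
      rw [← pow_mul, ← pow_mul, mul_comm]
    have hpos : (0 : ℝ) < (((q ^ f : ℕ) : ℝ) ^ p) ^ (p * e) := by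
      have : (0 : ℝ) < ((q ^ f : ℕ) : ℝ) := by exact_mod_cast h1
      positivity
    have hcoe : ((B * w : 𝓞 K) : K) = B * w := rfl
    rw [hw, hcoe, map_mul, norm_mul, mul_pow, hBn] at hGn
    have h3 : ‖φ w‖ ^ 2 = 1 := mul_left_cancel₀ hpos.ne' (by rw [hGn, mul_one])
    exact (pow_eq_one_iff_of_nonneg (norm_nonneg _) two_ne_zero).1 h3
  have hfin : IsOfFinOrder (w : K) := by
    obtain ⟨n, hn, hwn⟩ := NumberField.Embeddings.pow_eq_one_of_norm_eq_one K ℂ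
      w.isIntegral_coe hwnorm
    exact isOfFinOrder_iff_pow_eq_one.2 ⟨n, hn, hwn⟩
  obtain ⟨a, -, ha⟩ := hsemi
  rw [primeAbove, Ideal.span_singleton_pow, Ideal.mem_span_singleton] at ha
  obtain ⟨b, hb⟩ : ∃ b : ℤ, (ζ - 1) ^ 2 ∣ B - b := by
    refine ⟨∏ s : Gal(K/ℚ), (a : ℤ) ^ ((galEquivZMod p K s)⁻¹ : (ZMod p)ˣ).val.val, ?_⟩
    rw [← Ideal.mem_span_singleton, ← Ideal.Quotient.mk_eq_mk_iff_sub_mem, hB, Int.cast_prod,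
      map_prod, map_prod]
    refine Finset.prod_congr rfl fun s _ => ?_
    rw [Int.cast_pow, map_pow, map_pow]
    congr 1
    rw [Ideal.Quotient.mk_eq_mk_iff_sub_mem, Ideal.mem_span_singleton, Int.cast_natCast]
    exact sub_one_sq_dvd_smul_sub hζ ha s
  have hwb : (ζ - 1) ^ 2 ∣ w * b - 1 := by
    have h2 : w * b - 1 = ((G ^ p) ^ e - 1) - w * (B - b) := by
      rw [hw]
      ring
    rw [h2]
    exact dvd_sub hG1 (hb.mul_left _)
  rcases eq_one_or_neg_one_of_sub_one_sq_dvd hp2 hζ hfin hwb with h | h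
  · exact ⟨1, Or.inl rfl, by rw [hw, h]; simp⟩
  · exact ⟨-1, Or.inr rfl, by rw [hw, h]; simp⟩

end Comparison

/-! ### The power residue symbol of `p` modulo `𝔮` -/

section PowerResidue

variable {p q : ℕ} [Fact p.Prime] [Fact q.Prime] {K : Type*} [Field K] [NumberField K]

omit [Fact p.Prime] [Fact q.Prime] [NumberField K] in
theorem natCast_pow_sub_one_mem_iff (𝔮 : Ideal (𝓞 K)) [𝔮.LiesOver (Ideal.span {(q : ℤ)})]
    (M : ℕ) : (p : 𝓞 K) ^ M - 1 ∈ 𝔮 ↔ p ^ M ≡ 1 [MOD q] := by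
  have h1 := Ideal.mem_of_liesOver 𝔮 (Ideal.span {(q : ℤ)}) ((p : ℤ) ^ M - 1)
  rw [Ideal.mem_span_singleton] at h1
  simp only [map_sub, map_pow, map_natCast, map_one] at h1
  rw [← h1, Nat.ModEq.comm, Nat.modEq_iff_dvd]
  push_cast
  rfl

/-- If `p ∤ q - 1`, then `q - 1` divides `M = (q ^ f - 1) / p`. -/
theorem pow_modEq_one_of_not_modEq_one (hqp : q ≠ p) {f M : ℕ} (hM : p * M = q ^ f - 1)
    (h : ¬ q ≡ 1 [MOD p]) : p ^ M ≡ 1 [MOD q] := by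
  have hp : p.Prime := Fact.out
  have hq : q.Prime := Fact.out
  have hcop : (q - 1).Coprime p := by
    rw [Nat.coprime_comm, hp.coprime_iff_not_dvd]
    intro hdvd
    exact h ((Nat.modEq_iff_dvd' hq.one_le).2 hdvd).symm
  have hdvd : q - 1 ∣ M := by
    refine hcop.dvd_of_dvd_mul_left ?_
    rw [hM]
    simpa using Nat.sub_dvd_pow_sub_pow q 1 f
  obtain ⟨t, rfl⟩ := hdvd
  have h1 : p ^ q.totient ≡ 1 [MOD q] :=
    Nat.ModEq.pow_totient ((Nat.coprime_primes hp hq).2 hqp.symm)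
  rw [Nat.totient_prime hq] at h1
  rw [pow_mul]
  simpa using h1.pow t

/-- If `q ≡ 1` modulo `p`, then `𝔮` has degree one. -/
theorem eq_div_of_modEq_one [IsCyclotomicExtension {p} ℚ K] (hqp : q ≠ p) (𝔮 : Ideal (𝓞 K))
    [𝔮.IsPrime] [𝔮.LiesOver (Ideal.span {(q : ℤ)})] {f M : ℕ} (hf : Ideal.absNorm 𝔮 = q ^ f)
    (hM : p * M = q ^ f - 1) (h : q ≡ 1 [MOD p]) : M = (q - 1) / p := by
  have hp : p.Prime := Fact.out
  have hq : q.Prime := Fact.out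
  have hdeg := IsCyclotomicExtension.Rat.inertiaDeg_eq_of_not_dvd (m := p) q K 𝔮
    (fun hdvd => hqp ((Nat.prime_dvd_prime_iff_eq hq hp).1 hdvd))
  have h1 : (q : ZMod p) = 1 := by
    exact_mod_cast (ZMod.natCast_eq_natCast_iff q 1 p).2 h
  rw [h1, orderOf_one] at hdeg
  rw [← Ideal.pow_inertiaDeg q 𝔮, hdeg, pow_one] at hf
  rw [← hf] at hM
  rw [← hM, Nat.mul_div_cancel_left _ hp.pos]

end PowerResidue

/-! ### The congruences for `A ^ P(σ)` -/

theorem theoreml512164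
    (p : ℕ) [Fact p.Prime] (hp : p ≠ 2)
    (K : Type*) [Field K] [NumberField K] [IsCyclotomicExtension {p} ℚ K]
    (ζ : 𝓞 K) (hζ : IsPrimitiveRoot ζ p)
    -- a primitive root `v` modulo `p` and the automorphism `σ : ζ ↦ ζ ^ v`
    (v : (ZMod p)ˣ) (hv : ∀ x : (ZMod p)ˣ, x ∈ Subgroup.zpowers v)
    (σ : Gal(K/ℚ)) (hσ : σ • ζ = ζ ^ (v : ZMod p).val)
    -- a prime ideal `𝔮` over a rational prime `q ≠ p`
    (q : ℕ) (hq : q.Prime) (hqp : q ≠ p)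
    (𝔮 : Ideal (𝓞 K)) [𝔮.IsPrime] [𝔮.LiesOver (Ideal.span {(q : ℤ)})]
    (A : 𝓞 K) (hsing : IsSingularInt p A) (hsemi : IsSemiPrimary p ζ A)
    (hA : Ideal.span {A} = 𝔮 ^ p ∨ Ideal.span {A} = 𝔮 ^ (2 * p)) :
    ∃ δ : ℤ, (δ = 1 ∨ δ = -1) ∧
      (q ≡ 1 [MOD p] →
        stickelbergerPow v σ A - (δ : 𝓞 K) ∈ primeAbove ζ ^ (2 * p - 1)) ∧
      (¬ q ≡ 1 [MOD p] →
        stickelbergerPow v σ A - (δ : 𝓞 K) ∈ primeAbove ζ ^ (2 * p)) ∧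
      ((stickelbergerPow v σ A - (δ : 𝓞 K) ∈ primeAbove ζ ^ (2 * p - 1) ∧
          stickelbergerPow v σ A - (δ : 𝓞 K) ∉ primeAbove ζ ^ (2 * p)) ↔
        (q ≡ 1 [MOD p] ∧ ¬ p ^ ((q - 1) / p) ≡ 1 [MOD q])) := by
  have hpp : p.Prime := Fact.out
  have : Fact q.Prime := ⟨hq⟩
  obtain ⟨e, he, hAe⟩ : ∃ e : ℕ, (e = 1 ∨ e = 2) ∧ Ideal.span {A} = 𝔮 ^ (p * e) := by
    rcases hA with h | h
    · exact ⟨1, Or.inl rfl, by rw [h, mul_one]⟩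
    · exact ⟨2, Or.inr rfl, by rw [h, mul_comm]⟩
  have h3 : 3 ≤ p := by
    have := hpp.two_le
    omega
  obtain ⟨f, M, G, hf, hM, hnorm, hG, i, hi, hexp⟩ := exists_stickelberger_element hp hqp hζ 𝔮
  obtain ⟨r, hr⟩ := hexp e
  obtain ⟨δ, hδ, hB⟩ := exists_sign_mul_stickelbergerPow_eq hp hqp hζ hv hσ 𝔮 hsemi hAe hf hM
    hnorm hG (by
      rw [hr, add_sub_cancel_left]
      exact (pow_dvd_pow _ (by omega)).mul_right _)
  -- the `p`-th power residue symbol of `p` is trivial if and only if `p ∣ i`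
  have hnot : ¬ q ≡ 1 [MOD p] → p ∣ i := fun h => by
    rw [hi, natCast_pow_sub_one_mem_iff (q := q)]
    exact pow_modEq_one_of_not_modEq_one hqp hM h
  have hone : q ≡ 1 [MOD p] → (p ∣ i ↔ p ^ ((q - 1) / p) ≡ 1 [MOD q]) := fun h => by
    rw [hi, natCast_pow_sub_one_mem_iff (q := q), eq_div_of_modEq_one hqp 𝔮 hf hM h]
  have hδdvd : ∀ x y : 𝓞 K, x ∣ δ * y ↔ x ∣ y := by
    intro x y
    rcases hδ with rfl | rfl
    · simp
    · simp
  have hdiff : stickelbergerPow v σ A - (δ : 𝓞 K) =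
      δ * ((ζ - 1) ^ (2 * p - 1) * (e * i + (ζ - 1) * r)) := by
    rw [hB, hr]
    ring
  have hmem1 : stickelbergerPow v σ A - (δ : 𝓞 K) ∈ primeAbove ζ ^ (2 * p - 1) := by
    rw [primeAbove, Ideal.span_singleton_pow, Ideal.mem_span_singleton, hdiff, hδdvd]
    exact dvd_mul_right _ _
  have hmem2 : stickelbergerPow v σ A - (δ : 𝓞 K) ∈ primeAbove ζ ^ (2 * p) ↔ p ∣ i := by
    have hpow : (ζ - 1) ^ (2 * p) = (ζ - 1) ^ (2 * p - 1) * (ζ - 1) := by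
      rw [← pow_succ]
      congr 1
      omega
    have hcop : p.Coprime e := by
      rcases he with rfl | rfl
      · exact Nat.coprime_one_right p
      · exact (Nat.coprime_primes hpp Nat.prime_two).2 hp
    have hcast : ((e : 𝓞 K) * i) = (((e * i : ℕ) : ℤ) : 𝓞 K) := by push_cast; rfl
    rw [primeAbove, Ideal.span_singleton_pow, Ideal.mem_span_singleton, hdiff, hδdvd, hpow,
      mul_dvd_mul_iff_left (pow_ne_zero _ (hζ.sub_one_ne_zero hpp.one_lt)),
      dvd_add_left (dvd_mul_right _ _), hcast, sub_one_dvd_intCast_iff hζ,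
      Int.natCast_dvd_natCast, hcop.dvd_mul_left]
  refine ⟨δ, hδ, fun _ => hmem1, fun h => hmem2.2 (hnot h), ?_⟩
  rw [hmem2]
  constructor
  · rintro ⟨-, h⟩
    have hq1 : q ≡ 1 [MOD p] := by
      by_contra hq1
      exact h (hnot hq1)
    exact ⟨hq1, fun h' => h ((hone hq1).2 h')⟩
  · rintro ⟨hq1, h⟩
    exact ⟨hmem1, fun h' => h ((hone hq1).1 h')⟩
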